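/- Let $\mathbb K$ be a field of characteristic $0$. Let $\mathbf C$ be the category of finite-dimensional, nilpotent (hence non-unital), associative, graded-commutative, $\mathbb Z$-graded differential $\mathbb K$-algebras with differential of degree $+1$; its morphisms are the degree-$0$ algebra morphisms commuting with the differentials. A surjective morphism $A\to B$ in $\mathbf C$ with kernel $I$ is an *acyclic small extension* if $A\cdot I=0$ and the complex $I$ is acyclic. A functor $F:\mathbf C\to\mathbf{Set}$ is a *predeformation functor* if: 1. $F(0)$ is a one-point set; 2. for all morphisms $\alpha:A\to C$, $\beta:B\to C$ in $\mathbf C$ with $\alpha$ surjective, the natural map $F(A\times_C B)\to F(A)\times_{F(C)}F(B)$ is surjective, and it is bijective if moreover $C$ is acyclic and has zero multiplication; 3. for every acyclic small extension $A\to B$ the map $F(A)\to F(B)$ is surjective. It is a *deformation functor* if in addition the maps in (3) are bijective. If $F$ is a predeformation functor and $A\in\mathbf C$ has zero multiplication, then $F(A)$ is a $\mathbb K$-vector space, with sum $F(A)\times F(A)=F(A\times A)\to F(A)$ induced by $+:A\times A\to A$ and scalar multiplication induced by that of $A$. For a deformation functor $F$ put $T^iF=F(\mathbb K[i-1])$,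 where $\mathbb K[n]$ is $\mathbb K$ placed in degree $-n$, with zero multiplication and zero differential. Let $L$ be any $\mathbb Z$-graded differential graded Lie algebra over $\mathbb K$ (differential of degree $+1$). For $A\in\mathbf C$ the tensor product $L\otimes A$ is a differential graded Lie algebra with $$d(x\otimes a)=dx\otimes a+(-1)^{\deg x}x\otimes da,\qquad [x\otimes a,y\otimes b]=(-1)^{\deg a\,\deg y}[x,y]\otimes ab .$$ Let $MC(L\otimes A)=\{x\in(L\otimes A)^1: dx+\tfrac12[x,x]=0\}$. The group $\exp((L\otimes A)^0)$ acts on it by the gauge action $$e^a\cdot x=x+\sum_{n\ge 0}\frac{(\operatorname{ad}a)^n}{(n+1)!}\bigl([a,x]-da\bigr)$$ (a finite sum, since $A$ is nilpotent). Let $\mathrm{Def}_L(A)=MC(L\otimes A)/\exp((L\otimes A)^0)$, a functor $\mathrm{Def}_L:\mathbf C\to\mathbf{Set}$. **Theorem.** For every differential graded Lie algebra $L$ over $\mathbb K$, $\mathrm{Def}_L$ is a deformation functor. Moreover, for every $i\in\mathbb Z$ there is an isomorphism of $\mathbb K$-vector spaces $H^i(L)\cong T^i\,\mathrm{Def}_L=\mathrm{Def}_L(\mathbb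 K[i-1])$ which sends the class of a cocycle $z\in L^i$ to the class of the Maurer–Cartan element $z\otimes 1\in L\otimes\mathbb K[i-1]$. -/

import Mathlib

open CategoryTheory TensorProduct

universe u v w

/-! ### Graded vector spaces -/

namespace GradedSpace

variable {K : Type u} [Field K] {V : Type v} [AddCommGroup V] [Module K V]

/-- A property that is additive and holds for homogeneous elements holds everywhere. -/
theorem induction {gr : ℤ → Submodule K V} (h : DirectSum.IsInternal gr) {p : V → Prop}
    (hom : ∀ i, ∀ x ∈ gr i, p x) (add : ∀ x y, p x → p y → p (x + y)) (x : V) : p x := by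
  have hx : x ∈ ⨆ i, gr i := by rw [h.submodule_iSup_eq_top]; trivial
  exact Submodule.iSup_induction gr (motive := p) hx hom (hom 0 0 (zero_mem _)) add

/-- The decomposition of a graded vector space into its homogeneous parts. -/
noncomputable def decomp (gr : ℤ → Submodule K V) (h : DirectSum.IsInternal gr) :
    V ≃ₗ[K] DirectSum ℤ (fun i => gr i) :=
  letI := h.chooseDecomposition
  DirectSum.decomposeLinearEquiv gr

theorem decomp_apply {gr : ℤ → Submodule K V} (h : DirectSum.IsInternal gr) {i : ℤ} {x : V}
    (hx : x ∈ gr i) : decomp gr h x = DirectSum.lof K ℤ (fun i => gr i) i ⟨x, hx⟩ := by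
  let _ := h.chooseDecomposition
  exact DirectSum.decompose_of_mem gr hx

/-- The projection onto the part of degree `i`. -/
noncomputable def proj (gr : ℤ → Submodule K V) (h : DirectSum.IsInternal gr) (i : ℤ) :
    V →ₗ[K] V :=
  (gr i).subtype ∘ₗ DirectSum.component K ℤ (fun i => gr i) i ∘ₗ (decomp gr h).toLinearMap

theorem proj_mem {gr : ℤ → Submodule K V} (h : DirectSum.IsInternal gr) (i : ℤ) (x : V) :
    proj gr h i x ∈ gr i :=
  Subtype.property _

theorem proj_apply {gr : ℤ → Submodule K V} (h : DirectSum.IsInternal gr) {i j : ℤ} {x : V}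
    (hx : x ∈ gr j) : proj gr h i x = if i = j then x else 0 := by
  simp only [proj, LinearMap.comp_apply, LinearEquiv.coe_coe, decomp_apply h hx]
  split_ifs with hij
  · subst hij; simp [DirectSum.component.lof_self]
  · simp [DirectSum.component.of, Ne.symm hij]

theorem exists_sum_proj {gr : ℤ → Submodule K V} (h : DirectSum.IsInternal gr) (x : V) :
    ∃ s : Finset ℤ, ∀ t, s ⊆ t → ∑ i ∈ t, proj gr h i x = x := by
  classical
  induction x using induction h with
  | hom i x hx =>
    refine ⟨{i}, fun t ht => ?_⟩
    have hi : i ∈ t := ht (by simp)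
    simp [proj_apply h hx, hi]
  | add x y hx hy =>
    obtain ⟨s, hs⟩ := hx
    obtain ⟨s', hs'⟩ := hy
    refine ⟨s ∪ s', fun t ht => ?_⟩
    simp only [map_add, Finset.sum_add_distrib]
    rw [hs t (Finset.union_subset_left ht), hs' t (Finset.union_subset_right ht)]

/-- A criterion for a family of subspaces to be a grading. -/
theorem isInternal_of_proj {gr : ℤ → Submodule K V} (p : ℤ → V →ₗ[K] V)
    (hp : ∀ i j x, x ∈ gr j → p i x = if i = j then x else 0) (htop : ⨆ i, gr i = ⊤) :
    DirectSum.IsInternal gr := by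
  rw [DirectSum.isInternal_submodule_iff_iSupIndep_and_iSup_eq_top]
  refine ⟨?_, htop⟩
  intro i
  rw [Submodule.disjoint_def]
  intro x hx hx'
  have h1 : p i x = x := by simpa using hp i i x hx
  have h2 : (⨆ j, ⨆ _ : j ≠ i, gr j) ≤ LinearMap.ker (p i) := by
    refine iSup_le fun j => iSup_le fun hj y hy => ?_
    simp [hp i j y hy, Ne.symm hj]
  rw [← h1]
  exact h2 hx'

/-- The parity operator of a graded vector space: multiplication by `(-1) ^ i` in degree `i`. -/
noncomputable def parity (gr : ℤ → Submodule K V) (h : DirectSum.IsInternal gr) : V →ₗ[K] V :=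
  DirectSum.toModule K ℤ V (fun i => ((-1 : K) ^ i) • (gr i).subtype) ∘ₗ
    (decomp gr h).toLinearMap

theorem parity_apply {gr : ℤ → Submodule K V} (h : DirectSum.IsInternal gr) {i : ℤ} {x : V}
    (hx : x ∈ gr i) : parity gr h x = ((-1 : K) ^ i) • x := by
  simp [parity, decomp_apply h hx]

/-- Projection onto the even part, in characteristic different from two. -/
noncomputable def even (gr : ℤ → Submodule K V) (h : DirectSum.IsInternal gr) : V →ₗ[K] V :=
  (2⁻¹ : K) • (LinearMap.id + parity gr h)

/-- Projection onto the odd part, in characteristic different from two. -/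
noncomputable def odd (gr : ℤ → Submodule K V) (h : DirectSum.IsInternal gr) : V →ₗ[K] V :=
  (2⁻¹ : K) • (LinearMap.id - parity gr h)

/-- The cocycles of degree `i` of a graded vector space with an endomorphism `d`. -/
def cocycles (gr : ℤ → Submodule K V) (d : V →ₗ[K] V) (i : ℤ) : Submodule K V :=
  gr i ⊓ LinearMap.ker d

/-- The coboundaries of degree `i`. -/
def coboundaries (gr : ℤ → Submodule K V) (d : V →ₗ[K] V) (i : ℤ) : Submodule K V :=
  (gr (i - 1)).map d

/-- The cohomology in degree `i`: cocycles modulo coboundaries. -/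
abbrev cohomology (gr : ℤ → Submodule K V) (d : V →ₗ[K] V) (i : ℤ) : Type v :=
  cocycles gr d i ⧸ (coboundaries gr d i).submoduleOf (cocycles gr d i)

end GradedSpace

/-! ### The category of finite-dimensional nilpotent commutative dg-algebras -/

/-- The powers of a non-unital algebra: `algPow K A n` is `A ^ (n + 1)`. -/
def algPow (K : Type u) [Field K] (A : Type v) [NonUnitalRing A] [Module K A] :
    ℕ → Submodule K A
  | 0 => ⊤
  | n + 1 => Submodule.span K {c | ∃ a : A, ∃ b ∈ algPow K A n, c = a * b}

theorem algPow_antitone (K : Type u) [Field K] (A : Type v) [NonUnitalRing A] [Module K A] :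
    Antitone (algPow K A) := by
  refine antitone_nat_of_succ_le fun n => ?_
  induction n with
  | zero => exact le_top
  | succ n ih =>
    refine Submodule.span_mono ?_
    rintro _ ⟨a, b, hb, rfl⟩
    exact ⟨a, b, ih hb, rfl⟩

/-- A finite-dimensional, nilpotent, associative, graded-commutative, `ℤ`-graded differential
algebra over `K` (without unit). -/
structure NilpDGA (K : Type u) [Field K] where
  carrier : Type u
  [ring : NonUnitalRing carrier]
  [module : Module K carrier]
  [tower : IsScalarTower K carrier carrier]
  [smulComm : SMulCommClass K carrier carrier]
  [finite : FiniteDimensional K carrier]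
  gr : ℤ → Submodule K carrier
  isInternal : DirectSum.IsInternal gr
  d : carrier →ₗ[K] carrier
  mul_mem : ∀ {i j : ℤ} {a b : carrier}, a ∈ gr i → b ∈ gr j → a * b ∈ gr (i + j)
  mul_comm : ∀ {i j : ℤ} {a b : carrier}, a ∈ gr i → b ∈ gr j →
    a * b = ((-1 : K) ^ (i * j)) • (b * a)
  d_mem : ∀ {i : ℤ} {a : carrier}, a ∈ gr i → d a ∈ gr (i + 1)
  d_d : ∀ a, d (d a) = 0
  d_mul : ∀ {i : ℤ} {a : carrier} (b : carrier), a ∈ gr i →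
    d (a * b) = d a * b + ((-1 : K) ^ i) • (a * d b)
  nilpotent : ∃ n, algPow K carrier n = ⊥

attribute [instance] NilpDGA.ring NilpDGA.module NilpDGA.tower NilpDGA.smulComm NilpDGA.finite

namespace NilpDGA

variable {K : Type u} [Field K]

instance : CoeSort (NilpDGA K) (Type u) := ⟨NilpDGA.carrier⟩

/-- A morphism of dg-algebras: an algebra morphism of degree zero commuting with `d`. -/
@[ext]
structure Hom (A B : NilpDGA K) where
  toHom : A.carrier →ₙₐ[K] B.carrier
  map_gr : ∀ {i : ℤ} {a : A.carrier}, a ∈ A.gr i → toHom a ∈ B.gr i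
  map_d : ∀ a, toHom (A.d a) = B.d (toHom a)

instance : Category (NilpDGA K) where
  Hom A B := Hom A B
  id A := ⟨NonUnitalAlgHom.id K A, fun h => h, fun _ => rfl⟩
  comp f g := ⟨g.toHom.comp f.toHom, fun h => g.map_gr (f.map_gr h), fun a => by
    simp [f.map_d, g.map_d]⟩

/-- The linear map underlying a morphism. -/
def Hom.lin {A B : NilpDGA K} (f : A ⟶ B) : A →ₗ[K] B := (Hom.toHom f : A →ₗ[K] B)

@[simp] theorem lin_id (A : NilpDGA K) : Hom.lin (𝟙 A) = LinearMap.id := rfl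

@[simp] theorem lin_comp {A B C : NilpDGA K} (f : A ⟶ B) (g : B ⟶ C) :
    Hom.lin (f ≫ g) = Hom.lin g ∘ₗ Hom.lin f := rfl

theorem lin_mul {A B : NilpDGA K} (f : A ⟶ B) (x y : A) :
    Hom.lin f (x * y) = Hom.lin f x * Hom.lin f y := map_mul (Hom.toHom f) x y

theorem lin_mem {A B : NilpDGA K} (f : A ⟶ B) {i : ℤ} {x : A} (hx : x ∈ A.gr i) :
    Hom.lin f x ∈ B.gr i := Hom.map_gr f hx

theorem lin_d {A B : NilpDGA K} (f : A ⟶ B) (x : A) :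
    Hom.lin f (A.d x) = B.d (Hom.lin f x) := Hom.map_d f x

theorem hom_ext {A B : NilpDGA K} {f g : A ⟶ B} (h : ∀ x, Hom.lin f x = Hom.lin g x) :
    f = g :=
  Hom.ext (NonUnitalAlgHom.ext h)

/-- Build a morphism from a linear map. -/
def Hom.mk' {A B : NilpDGA K} (l : A →ₗ[K] B) (hm : ∀ x y, l (x * y) = l x * l y)
    (hg : ∀ {i : ℤ} {a : A}, a ∈ A.gr i → l a ∈ B.gr i) (hd : ∀ a, l (A.d a) = B.d (l a)) :
    A ⟶ B where
  toHom := { toFun := l, map_smul' := map_smul l, map_zero' := map_zero l,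
             map_add' := map_add l, map_mul' := hm }
  map_gr := hg
  map_d := hd

@[simp] theorem lin_mk' {A B : NilpDGA K} (l : A →ₗ[K] B) (hm) (hg) (hd) :
    Hom.lin (Hom.mk' (A := A) (B := B) l hm hg hd) = l := rfl

/-- The dg-algebras with trivial multiplication, i.e. those that are just complexes. -/
def IsTrivial (A : NilpDGA K) : Prop := ∀ a b : A, a * b = 0

/-- All cohomology vanishes. -/
def IsAcyclic (A : NilpDGA K) : Prop :=
  ∀ i, GradedSpace.cocycles A.gr A.d i ≤ GradedSpace.coboundaries A.gr A.d i

/-- A surjective morphism `A ⟶ B` whose kernel `I` satisfies `A I = 0` and is an acyclic complex: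
the datum of an acyclic small extension `0 → I → A → B → 0`. -/
structure IsAcyclicSmallExtension {A B : NilpDGA K} (f : A ⟶ B) : Prop where
  surjective : Function.Surjective (Hom.lin f)
  mul_eq_zero : ∀ a x : A, Hom.lin f x = 0 → a * x = 0
  acyclic : ∀ (i : ℤ) (x : A), x ∈ A.gr i → Hom.lin f x = 0 → A.d x = 0 →
    ∃ y ∈ A.gr (i - 1), Hom.lin f y = 0 ∧ A.d y = x

/-- The zero algebra. -/
def zeroObj (K : Type u) [Field K] : NilpDGA K where
  carrier := PUnit
  gr _ := ⊤
  isInternal := GradedSpace.isInternal_of_proj (fun _ => 0) (fun _ _ _ _ => rfl)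
    (Subsingleton.elim _ _)
  d := 0
  mul_mem _ _ := trivial
  mul_comm _ _ := rfl
  d_mem _ := trivial
  d_d _ := rfl
  d_mul _ _ := rfl
  nilpotent := ⟨0, Subsingleton.elim _ _⟩

instance : Subsingleton (zeroObj K : Type u) := inferInstanceAs (Subsingleton PUnit)

/-- The zero morphism. -/
def zeroHom (A B : NilpDGA K) : A ⟶ B :=
  Hom.mk' 0 (by simp) (fun _ => zero_mem _) (by simp)

@[simp] theorem lin_zeroHom (A B : NilpDGA K) : Hom.lin (zeroHom A B) = 0 := rfl

/-- The subalgebra of pairs `(a, b)` with `α a = β b`. -/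
def fiberSubalgebra {A B C : NilpDGA K} (α : A ⟶ C) (β : B ⟶ C) :
    NonUnitalSubalgebra K (A × B) where
  carrier := {p | Hom.lin α p.1 = Hom.lin β p.2}
  add_mem' {p q} hp hq := by
    simp only [Set.mem_ofPred_eq] at *
    simp [hp, hq]
  zero_mem' := by simp
  mul_mem' {p q} hp hq := by
    simp only [Set.mem_ofPred_eq] at *
    simp [lin_mul, hp, hq]
  smul_mem' c p hp := by
    simp only [Set.mem_ofPred_eq] at *
    simp [hp]

/-- The two projections of the fibre product, as linear maps. -/
def fiberFst {A B C : NilpDGA K} (α : A ⟶ C) (β : B ⟶ C) : fiberSubalgebra α β →ₗ[K] A :=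
  LinearMap.fst K A B ∘ₗ (fiberSubalgebra α β).toSubmodule.subtype

def fiberSnd {A B C : NilpDGA K} (α : A ⟶ C) (β : B ⟶ C) : fiberSubalgebra α β →ₗ[K] B :=
  LinearMap.snd K A B ∘ₗ (fiberSubalgebra α β).toSubmodule.subtype

theorem proj_lin {A B : NilpDGA K} (f : A ⟶ B) (i : ℤ) (x : A) :
    GradedSpace.proj B.gr B.isInternal i (Hom.lin f x) =
      Hom.lin f (GradedSpace.proj A.gr A.isInternal i x) := by
  induction x using GradedSpace.induction A.isInternal with
  | hom j x hx =>
    rw [GradedSpace.proj_apply _ hx, GradedSpace.proj_apply _ (lin_mem f hx)]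
    split_ifs <;> simp
  | add x y hx hy => simp [hx, hy]

/-- The fibre product `A ×_C B` of dg-algebras, with componentwise structure. -/
def fiberProd {A B C : NilpDGA K} (α : A ⟶ C) (β : B ⟶ C) : NilpDGA K where
  carrier := fiberSubalgebra α β
  finite := FiniteDimensional.finiteDimensional_submodule (fiberSubalgebra α β).toSubmodule
  gr i := (A.gr i).comap (fiberFst α β) ⊓ (B.gr i).comap (fiberSnd α β)
  isInternal := by
    classical
    let p : ℤ → fiberSubalgebra α β →ₗ[K] fiberSubalgebra α β := fun i =>
      LinearMap.codRestrict (fiberSubalgebra α β).toSubmodule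
        (LinearMap.prod (GradedSpace.proj A.gr A.isInternal i ∘ₗ fiberFst α β)
          (GradedSpace.proj B.gr B.isInternal i ∘ₗ fiberSnd α β))
        (fun x => by
          have hx : Hom.lin α x.1.1 = Hom.lin β x.1.2 := x.2
          change Hom.lin α (GradedSpace.proj A.gr A.isInternal i x.1.1) =
            Hom.lin β (GradedSpace.proj B.gr B.isInternal i x.1.2)
          rw [← proj_lin, ← proj_lin, hx])
    refine GradedSpace.isInternal_of_proj p (fun i j x hx => ?_) ?_
    · apply Subtype.ext
      apply Prod.ext
      · change GradedSpace.proj A.gr A.isInternal i (fiberFst α β x) = _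
        rw [GradedSpace.proj_apply _ hx.1]
        split_ifs <;> rfl
      · change GradedSpace.proj B.gr B.isInternal i (fiberSnd α β x) = _
        rw [GradedSpace.proj_apply _ hx.2]
        split_ifs <;> rfl
    · rw [eq_top_iff]
      intro x _
      obtain ⟨s, hs⟩ := GradedSpace.exists_sum_proj A.isInternal (fiberFst α β x)
      obtain ⟨t, ht⟩ := GradedSpace.exists_sum_proj B.isInternal (fiberSnd α β x)
      have hx : x = ∑ i ∈ s ∪ t, p i x := by
        apply Subtype.ext
        apply Prod.ext
        · change fiberFst α β x = fiberFst α β _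
          rw [map_sum]
          exact (hs _ Finset.subset_union_left).symm
        · change fiberSnd α β x = fiberSnd α β _
          rw [map_sum]
          exact (ht _ Finset.subset_union_right).symm
      rw [hx]
      refine Submodule.sum_mem _ fun i _ => Submodule.mem_iSup_of_mem i ⟨?_, ?_⟩
      · exact GradedSpace.proj_mem A.isInternal i _
      · exact GradedSpace.proj_mem B.isInternal i _
  d := LinearMap.codRestrict (fiberSubalgebra α β).toSubmodule
        (LinearMap.prod (A.d ∘ₗ fiberFst α β) (B.d ∘ₗ fiberSnd α β))
        (fun x => by
          change Hom.lin α (A.d x.1.1) = Hom.lin β (B.d x.1.2)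
          have hx : Hom.lin α x.1.1 = Hom.lin β x.1.2 := x.2
          rw [lin_d, lin_d, hx])
  mul_mem ha hb := ⟨A.mul_mem ha.1 hb.1, B.mul_mem ha.2 hb.2⟩
  mul_comm ha hb := Subtype.ext (Prod.ext (A.mul_comm ha.1 hb.1) (B.mul_comm ha.2 hb.2))
  d_mem ha := ⟨A.d_mem ha.1, B.d_mem ha.2⟩
  d_d a := Subtype.ext (Prod.ext (A.d_d _) (B.d_d _))
  d_mul b ha := Subtype.ext (Prod.ext (A.d_mul _ ha.1) (B.d_mul _ ha.2))
  nilpotent := by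
    obtain ⟨m, hm⟩ := A.nilpotent
    obtain ⟨n, hn⟩ := B.nilpotent
    have key : ∀ k, algPow K (fiberSubalgebra α β) k ≤
        (algPow K A k).comap (fiberFst α β) ⊓ (algPow K B k).comap (fiberSnd α β) := by
      intro k
      induction k with
      | zero => exact fun _ _ => ⟨trivial, trivial⟩
      | succ k ih =>
        refine Submodule.span_le.2 ?_
        rintro _ ⟨a, b, hb, rfl⟩
        exact ⟨Submodule.subset_span ⟨_, _, (ih hb).1, rfl⟩,
          Submodule.subset_span ⟨_, _, (ih hb).2, rfl⟩⟩
    refine ⟨max m n, ?_⟩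
    rw [eq_bot_iff]
    intro x hx
    have h := key _ hx
    have h1 : fiberFst α β x ∈ (⊥ : Submodule K A) :=
      hm ▸ algPow_antitone K A (le_max_left m n) h.1
    have h2 : fiberSnd α β x ∈ (⊥ : Submodule K B) :=
      hn ▸ algPow_antitone K B (le_max_right m n) h.2
    exact Subtype.ext (Prod.ext h1 h2)

/-- The two projections of the fibre product. -/
def fst {A B C : NilpDGA K} (α : A ⟶ C) (β : B ⟶ C) : fiberProd α β ⟶ A :=
  Hom.mk' (fiberFst α β) (fun _ _ => rfl) (fun h => h.1) (fun _ => rfl)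

def snd {A B C : NilpDGA K} (α : A ⟶ C) (β : B ⟶ C) : fiberProd α β ⟶ B :=
  Hom.mk' (fiberSnd α β) (fun _ _ => rfl) (fun h => h.2) (fun _ => rfl)

theorem fiber_condition {A B C : NilpDGA K} (α : A ⟶ C) (β : B ⟶ C) :
    fst α β ≫ α = snd α β ≫ β :=
  hom_ext fun x => x.2

/-- The morphism into a fibre product with given components. -/
def lift {X A B C : NilpDGA K} (α : A ⟶ C) (β : B ⟶ C) (f : X ⟶ A) (g : X ⟶ B)
    (h : f ≫ α = g ≫ β) : X ⟶ fiberProd α β :=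
  Hom.mk' (LinearMap.codRestrict (fiberSubalgebra α β).toSubmodule
      (LinearMap.prod (Hom.lin f) (Hom.lin g))
      (fun x => LinearMap.congr_fun (congrArg Hom.lin h) x))
    (fun x y => Subtype.ext (Prod.ext (lin_mul f x y) (lin_mul g x y)))
    (fun hx => ⟨lin_mem f hx, lin_mem g hx⟩)
    (fun x => Subtype.ext (Prod.ext (lin_d f x) (lin_d g x)))

theorem lift_fst {X A B C : NilpDGA K} (α : A ⟶ C) (β : B ⟶ C) (f : X ⟶ A) (g : X ⟶ B)
    (h : f ≫ α = g ≫ β) : lift α β f g h ≫ fst α β = f := rfl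

theorem lift_snd {X A B C : NilpDGA K} (α : A ⟶ C) (β : B ⟶ C) (f : X ⟶ A) (g : X ⟶ B)
    (h : f ≫ α = g ≫ β) : lift α β f g h ≫ snd α β = g := rfl

/-- The underlying space of the complex `K[n]`. -/
def Line (K : Type u) : Type u := K

instance : AddCommGroup (Line K) := inferInstanceAs (AddCommGroup K)
instance : Module K (Line K) := inferInstanceAs (Module K K)
instance : FiniteDimensional K (Line K) := inferInstanceAs (FiniteDimensional K K)

/-- `K` with the zero multiplication. -/
instance : NonUnitalRing (Line K) where
  mul _ _ := 0
  left_distrib _ _ _ := (add_zero (0 : Line K)).symm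
  right_distrib _ _ _ := (add_zero (0 : Line K)).symm
  zero_mul _ := rfl
  mul_zero _ := rfl
  mul_assoc _ _ _ := rfl

theorem Line.mul_eq (a b : Line K) : a * b = 0 := rfl

instance : IsScalarTower K (Line K) (Line K) :=
  ⟨fun c _ _ => (smul_zero c).symm⟩
instance : SMulCommClass K (Line K) (Line K) :=
  ⟨fun c _ _ => smul_zero c⟩

/-- The complex `K[n]`: a copy of `K` in degree `-n`, with zero differential and zero
multiplication. -/
def line (K : Type u) [Field K] (n : ℤ) : NilpDGA K where
  carrier := Line K
  gr i := if i + n = 0 then ⊤ else ⊥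
  isInternal := by
    refine GradedSpace.isInternal_of_proj (fun i => if i + n = 0 then LinearMap.id else 0)
      (fun i j x hx => ?_) ?_
    · by_cases hj : j + n = 0
      · by_cases hi : i + n = 0
        · have : i = j := by omega
          subst this
          simp [hi]
        · have : i ≠ j := by omega
          simp [hi, this]
      · have : x = 0 := by simpa [hj] using hx
        simp [this]
    · rw [eq_top_iff]
      exact le_iSup_of_le (-n) (by simp)
  d := 0
  mul_mem _ _ := zero_mem _
  mul_comm _ _ := (smul_zero _).symm
  d_mem _ := zero_mem _
  d_d _ := rfl
  d_mul _ _ := by simp [Line.mul_eq]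
  nilpotent := ⟨1, by
    rw [eq_bot_iff]
    refine Submodule.span_le.2 ?_
    rintro _ ⟨a, b, -, rfl⟩
    rfl⟩

/-- The generator `1` of `K[n]`. -/
def Line.one (K : Type u) [Field K] : Line K := (1 : K)

theorem line_isTrivial (n : ℤ) : (line K n).IsTrivial := fun _ _ => rfl

theorem zeroObj_isTrivial : (zeroObj K).IsTrivial := fun _ _ => rfl

theorem zeroObj_isAcyclic : (zeroObj K).IsAcyclic := fun _ _ _ =>
  ⟨0, zero_mem _, Subsingleton.elim _ _⟩

/-- The sum of two morphisms into a dg-algebra with trivial multiplication. -/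
def addHom {X A : NilpDGA K} (hA : A.IsTrivial) (hX : X.IsTrivial) (f g : X ⟶ A) : X ⟶ A :=
  Hom.mk' (Hom.lin f + Hom.lin g) (fun x y => by rw [hX, map_zero, hA])
    (fun h => add_mem (lin_mem f h) (lin_mem g h)) (fun a => by simp [lin_d])

/-- A scalar multiple of a morphism into a dg-algebra with trivial multiplication. -/
def smulHom {X A : NilpDGA K} (hA : A.IsTrivial) (hX : X.IsTrivial) (c : K) (f : X ⟶ A) :
    X ⟶ A :=
  Hom.mk' (c • Hom.lin f) (fun x y => by rw [hX, map_zero, hA])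
    (fun h => Submodule.smul_mem _ c (lin_mem f h)) (fun a => by simp [lin_d])

@[simp] theorem lin_addHom {X A : NilpDGA K} (hA : A.IsTrivial) (hX : X.IsTrivial)
    (f g : X ⟶ A) : Hom.lin (addHom hA hX f g) = Hom.lin f + Hom.lin g := rfl

@[simp] theorem lin_smulHom {X A : NilpDGA K} (hA : A.IsTrivial) (hX : X.IsTrivial) (c : K)
    (f : X ⟶ A) : Hom.lin (smulHom hA hX c f) = c • Hom.lin f := rfl

/-- The product `A × B`, as the fibre product over `0`. -/
abbrev prod (A B : NilpDGA K) : NilpDGA K :=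
  fiberProd (zeroHom A (zeroObj K)) (zeroHom B (zeroObj K))

theorem IsTrivial.prod {A B : NilpDGA K} (hA : A.IsTrivial) (hB : B.IsTrivial) :
    (A.prod B).IsTrivial :=
  fun _ _ => Subtype.ext (Prod.ext (hA _ _) (hB _ _))

/-- The first and second projection of a product. -/
abbrev pr₁ (A B : NilpDGA K) : A.prod B ⟶ A := fst _ _
abbrev pr₂ (A B : NilpDGA K) : A.prod B ⟶ B := snd _ _

/-- The morphism into a product with given components. -/
abbrev pair {X A B : NilpDGA K} (f : X ⟶ A) (g : X ⟶ B) : X ⟶ A.prod B :=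
  lift _ _ f g (hom_ext fun _ => rfl)

end NilpDGA

/-! ### Deformation functors -/

section Deformation

open NilpDGA

variable {K : Type u} [Field K]

/-- The comparison map `F (A ×_C B) → F A ×_{F C} F B`. -/
def comparison (F : NilpDGA K ⥤ Type w) {A B C : NilpDGA K} (α : A ⟶ C) (β : B ⟶ C) :
    F.obj (fiberProd α β) → {p : F.obj A × F.obj B // F.map α p.1 = F.map β p.2} :=
  fun z => ⟨(F.map (fst α β) z, F.map (snd α β) z), by
    change F.map α (F.map (fst α β) z) = F.map β (F.map (snd α β) z)
    rw [← Functor.map_comp_apply, ← Functor.map_comp_apply, fiber_condition]⟩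

/-- Predeformation functors: `F 0` is a point, the generalized Schlessinger conditions hold, and
`F` is quasismooth. -/
structure IsPredeformationFunctor (F : NilpDGA K ⥤ Type w) : Prop where
  zero : ∃ x : F.obj (zeroObj K), ∀ y, y = x
  surjective : ∀ {A B C : NilpDGA K} (α : A ⟶ C) (β : B ⟶ C),
    Function.Surjective (Hom.lin α) → Function.Surjective (comparison F α β)
  bijective : ∀ {A B C : NilpDGA K} (α : A ⟶ C) (β : B ⟶ C),
    Function.Surjective (Hom.lin α) → C.IsTrivial → C.IsAcyclic →
      Function.Bijective (comparison F α β)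
  quasismooth : ∀ {A B : NilpDGA K} (f : A ⟶ B), IsAcyclicSmallExtension f →
    Function.Surjective (F.map f)

/-- Deformation functors: predeformation functors that send acyclic small extensions to
bijections. -/
structure IsDeformationFunctor (F : NilpDGA K ⥤ Type w) : Prop
    extends IsPredeformationFunctor F where
  acyclic_bijective : ∀ {A B : NilpDGA K} (f : A ⟶ B), IsAcyclicSmallExtension f →
    Function.Bijective (F.map f)

namespace IsPredeformationFunctor

variable {F : NilpDGA K ⥤ Type w} (hF : IsPredeformationFunctor F)

/-- The identification `F (A × B) = F A × F B`. -/
theorem prod_bijective {F : NilpDGA K ⥤ Type w} (hF : IsPredeformationFunctor F) (A B : NilpDGA K) : Function.Bijective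
    (fun z : F.obj (A.prod B) => (F.map (pr₁ A B) z, F.map (pr₂ A B) z)) := by
  obtain ⟨pt, hpt⟩ := hF.zero
  have h := hF.bijective (zeroHom A (zeroObj K)) (zeroHom B (zeroObj K))
    (fun _ => ⟨0, Subsingleton.elim _ _⟩) zeroObj_isTrivial zeroObj_isAcyclic
  refine ⟨fun x y hxy => h.1 (Subtype.ext hxy), fun p => ?_⟩
  obtain ⟨z, hz⟩ := h.2 ⟨p, (hpt _).trans (hpt _).symm⟩
  exact ⟨z, congrArg Subtype.val hz⟩

/-- The equivalence `F (A × B) ≃ F A × F B`. -/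
noncomputable def prodEquiv (A B : NilpDGA K) : F.obj (A.prod B) ≃ F.obj A × F.obj B :=
  Equiv.ofBijective _ (hF.prod_bijective A B)

/-- The vector space `F A`, for `A` a complex (trivial multiplication). -/
def Vec (_hF : IsPredeformationFunctor F) (A : NilpDGA K) (_hA : A.IsTrivial) : Type w := F.obj A

variable {A : NilpDGA K} (hA : A.IsTrivial)

/-- The sum is `F A × F A = F (A × A) → F A`, induced by the sum `A × A → A`. -/
noncomputable instance : Add (hF.Vec A hA) where
  add x y := F.map (addHom hA (hA.prod hA) (pr₁ A A) (pr₂ A A)) ((hF.prodEquiv A A).symm (x, y))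

/-- Scalar multiplication is induced by scalar multiplication of `A`. -/
instance : SMul K (hF.Vec A hA) where
  smul c x := F.map (smulHom hA hA c (𝟙 A)) x

/-- The origin is the image of the point `F 0`. -/
noncomputable instance : Zero (hF.Vec A hA) where
  zero := F.map (zeroHom (zeroObj K) A) hF.zero.choose

noncomputable instance : Neg (hF.Vec A hA) where
  neg x := (-1 : K) • x

/-- View an element of `F A` as a vector. -/
def toVec (x : F.obj A) : hF.Vec A hA := x

theorem map_addHom {X : NilpDGA K} (hX : X.IsTrivial) (f g : X ⟶ A) (x : F.obj X) :
    hF.toVec hA (F.map (addHom hA hX f g) x) =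
      hF.toVec hA (F.map f x) + hF.toVec hA (F.map g x) := by
  have h : (hF.prodEquiv A A).symm (F.map f x, F.map g x) = F.map (pair f g) x := by
    rw [Equiv.symm_apply_eq]
    apply Prod.ext
    · change _ = F.map _ (F.map _ x)
      rw [← Functor.map_comp_apply, lift_fst]
    · change _ = F.map _ (F.map _ x)
      rw [← Functor.map_comp_apply, lift_snd]
  change _ = F.map _ ((hF.prodEquiv A A).symm (F.map f x, F.map g x))
  rw [h, ← Functor.map_comp_apply]
  rfl

theorem map_smulHom {X : NilpDGA K} (hX : X.IsTrivial) (c : K) (f : X ⟶ A) (x : F.obj X) :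
    hF.toVec hA (F.map (smulHom hA hX c f) x) = c • hF.toVec hA (F.map f x) := by
  change _ = F.map _ (F.map f x)
  rw [← Functor.map_comp_apply]
  rfl

theorem map_zeroHom {X : NilpDGA K} (x : F.obj X) :
    hF.toVec hA (F.map (zeroHom X A) x) = 0 := by
  change _ = F.map _ hF.zero.choose
  have : F.map (zeroHom X (zeroObj K)) x = hF.zero.choose := hF.zero.choose_spec _
  rw [← this, ← Functor.map_comp_apply]
  rfl

theorem exists_pair (x y : hF.Vec A hA) : ∃ z : F.obj (A.prod A),
    x = hF.toVec hA (F.map (pr₁ A A) z) ∧ y = hF.toVec hA (F.map (pr₂ A A) z) := by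
  obtain ⟨z, hz⟩ := (hF.prod_bijective A A).2 (x, y)
  exact ⟨z, (congrArg Prod.fst hz).symm, (congrArg Prod.snd hz).symm⟩

theorem toVec_eq (x : hF.Vec A hA) : x = hF.toVec hA (F.map (𝟙 A) x) :=
  (Functor.map_id_apply F A x).symm

noncomputable instance : AddCommGroup (hF.Vec A hA) where
  add_assoc x y z := by
    obtain ⟨t, rfl, rfl⟩ := hF.exists_pair hA x y
    obtain ⟨s, hs⟩ := (hF.prod_bijective (A.prod A) A).2 (t, z)
    obtain ⟨rfl, rfl⟩ := Prod.ext_iff.1 hs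
    have hX := (hA.prod hA).prod hA
    change hF.toVec hA _ + hF.toVec hA _ + hF.toVec hA (F.map _ s) =
      hF.toVec hA _ + (hF.toVec hA _ + hF.toVec hA (F.map _ s))
    simp only [← Functor.map_comp_apply, ← map_addHom hF hA hX]
    exact congrArg (fun f => hF.toVec hA (F.map f s)) (hom_ext fun _ => add_assoc _ _ _)
  add_comm x y := by
    obtain ⟨t, rfl, rfl⟩ := hF.exists_pair hA x y
    simp only [← map_addHom hF hA (hA.prod hA)]
    exact congrArg (fun f => hF.toVec hA (F.map f t)) (hom_ext fun _ => add_comm _ _)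
  zero_add x := by
    have h : ∀ y : F.obj A, hF.toVec hA (F.map (zeroHom A A) y) + hF.toVec hA (F.map (𝟙 A) y) =
        hF.toVec hA (F.map (𝟙 A) y) := fun y => by
      rw [← map_addHom hF hA hA]
      exact congrArg (fun f => hF.toVec hA (F.map f y)) (hom_ext fun _ => zero_add _)
    simp only [hF.map_zeroHom hA] at h
    have h' := h x
    rwa [← hF.toVec_eq hA x] at h'
  add_zero x := by
    have h : ∀ y : F.obj A, hF.toVec hA (F.map (𝟙 A) y) + hF.toVec hA (F.map (zeroHom A A) y) =
        hF.toVec hA (F.map (𝟙 A) y) := fun y => by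
      rw [← map_addHom hF hA hA]
      exact congrArg (fun f => hF.toVec hA (F.map f y)) (hom_ext fun _ => add_zero _)
    simp only [hF.map_zeroHom hA] at h
    have h' := h x
    rwa [← hF.toVec_eq hA x] at h'
  nsmul := nsmulRec
  zsmul := zsmulRec
  neg_add_cancel x := by
    have h : ∀ y : F.obj A, (-1 : K) • hF.toVec hA (F.map (𝟙 A) y) +
        hF.toVec hA (F.map (𝟙 A) y) = hF.toVec hA (F.map (zeroHom A A) y) := fun y => by
      rw [← map_smulHom hF hA hA, ← map_addHom hF hA hA]
      exact congrArg (fun f => hF.toVec hA (F.map f y)) (hom_ext fun z => by simp)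
    simp only [hF.map_zeroHom hA] at h
    have h' := h x
    rwa [← hF.toVec_eq hA x] at h'

noncomputable instance : Module K (hF.Vec A hA) where
  one_smul x := by
    have h : ∀ y : F.obj A, (1 : K) • hF.toVec hA (F.map (𝟙 A) y) =
        hF.toVec hA (F.map (𝟙 A) y) := fun y => by
      rw [← map_smulHom hF hA hA]
      exact congrArg (fun f => hF.toVec hA (F.map f y)) (hom_ext fun z => by simp)
    have h' := h x
    rwa [← hF.toVec_eq hA x] at h'
  mul_smul c c' x := by
    have h : ∀ y : F.obj A, (c * c') • hF.toVec hA (F.map (𝟙 A) y) =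
        c • c' • hF.toVec hA (F.map (𝟙 A) y) := fun y => by
      simp only [← map_smulHom hF hA hA]
      exact congrArg (fun f => hF.toVec hA (F.map f y)) (hom_ext fun z => by simp [mul_smul])
    have h' := h x
    rwa [← hF.toVec_eq hA x] at h'
  smul_zero c := by
    obtain ⟨pt, -⟩ := hF.zero
    have h : c • hF.toVec hA (F.map (zeroHom (zeroObj K) A) pt) =
        hF.toVec hA (F.map (zeroHom (zeroObj K) A) pt) := by
      rw [← map_smulHom hF hA zeroObj_isTrivial]
      exact congrArg (fun f => hF.toVec hA (F.map f pt)) (hom_ext fun z => by simp)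
    rwa [hF.map_zeroHom hA] at h
  zero_smul x := by
    have h : ∀ y : F.obj A, (0 : K) • hF.toVec hA (F.map (𝟙 A) y) =
        hF.toVec hA (F.map (zeroHom A A) y) := fun y => by
      rw [← map_smulHom hF hA hA]
      exact congrArg (fun f => hF.toVec hA (F.map f y)) (hom_ext fun z => by simp)
    simp only [hF.map_zeroHom hA] at h
    have h' := h x
    rwa [← hF.toVec_eq hA x] at h'
  smul_add c x y := by
    obtain ⟨t, rfl, rfl⟩ := hF.exists_pair hA x y
    simp only [← map_addHom hF hA (hA.prod hA), ← map_smulHom hF hA (hA.prod hA)]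
    exact congrArg (fun f => hF.toVec hA (F.map f t)) (hom_ext fun _ => smul_add _ _ _)
  add_smul c c' x := by
    have h : ∀ y : F.obj A, (c + c') • hF.toVec hA (F.map (𝟙 A) y) =
        c • hF.toVec hA (F.map (𝟙 A) y) + c' • hF.toVec hA (F.map (𝟙 A) y) := fun y => by
      simp only [← map_smulHom hF hA hA, ← map_addHom hF hA hA]
      exact congrArg (fun f => hF.toVec hA (F.map f y)) (hom_ext fun z => by simp [add_smul])
    have h' := h x
    rwa [← hF.toVec_eq hA x] at h'

end IsPredeformationFunctor

/-- The tangent space `T^i F = F (K[i - 1])` of a deformation functor. -/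
abbrev IsDeformationFunctor.tangentSpace {F : NilpDGA K ⥤ Type w} (hF : IsDeformationFunctor F)
    (i : ℤ) : Type w :=
  hF.toIsPredeformationFunctor.Vec (line K (i - 1)) (line_isTrivial (i - 1))

end Deformation

/-! ### Differential graded Lie algebras -/

/-- A `ℤ`-graded differential Lie algebra over `K`. -/
structure DGLA (K : Type u) [Field K] where
  carrier : Type v
  [addCommGroup : AddCommGroup carrier]
  [module : Module K carrier]
  gr : ℤ → Submodule K carrier
  isInternal : DirectSum.IsInternal gr
  d : carrier →ₗ[K] carrier
  bracket : carrier →ₗ[K] carrier →ₗ[K] carrier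
  d_mem : ∀ {i : ℤ} {x : carrier}, x ∈ gr i → d x ∈ gr (i + 1)
  d_d : ∀ x, d (d x) = 0
  bracket_mem : ∀ {i j : ℤ} {x y : carrier}, x ∈ gr i → y ∈ gr j → bracket x y ∈ gr (i + j)
  skew : ∀ {i j : ℤ} {x y : carrier}, x ∈ gr i → y ∈ gr j →
    bracket x y + ((-1 : K) ^ (i * j)) • bracket y x = 0
  jacobi : ∀ {i j k : ℤ} {x y z : carrier}, x ∈ gr i → y ∈ gr j → z ∈ gr k →
    bracket x (bracket y z) =
      bracket (bracket x y) z + ((-1 : K) ^ (i * j)) • bracket y (bracket x z)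
  leibniz : ∀ {i j : ℤ} {x y : carrier}, x ∈ gr i → y ∈ gr j →
    d (bracket x y) = bracket (d x) y + ((-1 : K) ^ i) • bracket x (d y)

attribute [instance] DGLA.addCommGroup DGLA.module

namespace DGLA

variable {K : Type u} [Field K]

instance : CoeSort (DGLA.{u, v} K) (Type v) := ⟨DGLA.carrier⟩

/-- The cohomology `H^i(L)`. -/
abbrev H (L : DGLA.{u, v} K) (i : ℤ) : Type v := GradedSpace.cohomology L.gr L.d i

/-- The Maurer-Cartan elements: `x` of degree one with `d x + [x, x] / 2 = 0`. -/
def MC (L : DGLA.{u, v} K) : Type v :=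
  {x : L // x ∈ L.gr 1 ∧ L.d x + (2⁻¹ : K) • L.bracket x x = 0}

/-- The operator `[a, ·]_d` on `L_d = L ⊕ K d`, for `a` of degree zero:
`b + β d ↦ [a, b] - β d(a)`. -/
def adExt (L : DGLA.{u, v} K) (a : L) : L × K →ₗ[K] L × K :=
  LinearMap.inl K L K ∘ₗ
    (L.bracket a ∘ₗ LinearMap.fst K L K -
      (LinearMap.toSpanSingleton K L (L.d a)) ∘ₗ LinearMap.snd K L K)

theorem adExt_apply (L : DGLA.{u, v} K) (a b : L) (β : K) :
    L.adExt a (b, β) = (L.bracket a b - β • L.d a, 0) := rfl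

/-- The gauge transformation `e ^ a • b = e ^ (ad a) (b + d) - d`, the exponential being taken in
`L_d = L ⊕ K d`; it is meaningful when `[a, ·]_d` is nilpotent (the sum is then finite). -/
noncomputable def gauge (L : DGLA.{u, v} K) (a b : L) : L :=
  (∑ᶠ n : ℕ, ((n.factorial : K)⁻¹) • ((L.adExt a) ^ n) (b, 1)).1

/-- Gauge equivalence: `y = e ^ a • x` for some `a` of degree zero. -/
def GaugeRel (L : DGLA.{u, v} K) (x y : L.MC) : Prop :=
  ∃ a ∈ L.gr 0, y.1 = L.gauge a x.1

/-- A morphism of differential graded Lie algebras. -/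
structure Hom (L : DGLA.{u, v} K) (N : DGLA.{u, w} K) where
  lin : L →ₗ[K] N
  map_gr : ∀ {i : ℤ} {x : L}, x ∈ L.gr i → lin x ∈ N.gr i
  map_d : ∀ x, lin (L.d x) = N.d (lin x)
  map_bracket : ∀ x y, lin (L.bracket x y) = N.bracket (lin x) (lin y)

/-- The map on Maurer-Cartan elements. -/
def Hom.mapMC {L : DGLA.{u, v} K} {N : DGLA.{u, w} K} (f : Hom L N) (x : L.MC) : N.MC :=
  ⟨f.lin x.1, f.map_gr x.2.1, by
    rw [← f.map_bracket, ← f.map_d, ← map_smul, ← map_add, x.2.2, map_zero]⟩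

/-- Gauge transformations commute with morphisms (if the exponential series is a finite sum). -/
theorem Hom.map_gauge {L : DGLA.{u, v} K} {N : DGLA.{u, w} K} (f : Hom L N) (a b : L)
    (ha : ∃ n, ∀ m, n ≤ m → ((L.adExt a) ^ m) (b, 1) = 0) :
    f.lin (L.gauge a b) = N.gauge (f.lin a) (f.lin b) := by
  obtain ⟨n, hn⟩ := ha
  let g : L × K →ₗ[K] N × K := LinearMap.prodMap f.lin LinearMap.id
  have hg : ∀ p, g (L.adExt a p) = N.adExt (f.lin a) (g p) := by
    rintro ⟨p, β⟩
    simp [g, adExt_apply, f.map_bracket, f.map_d]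
  have hg' : ∀ m p, g (((L.adExt a) ^ m) p) = ((N.adExt (f.lin a)) ^ m) (g p) := by
    intro m
    induction m with
    | zero => intro p; rfl
    | succ m ih => intro p; rw [pow_succ, pow_succ, Module.End.mul_apply, Module.End.mul_apply,
        ih, hg]
  have hfin : (Function.support fun m : ℕ =>
      ((m.factorial : K)⁻¹) • ((L.adExt a) ^ m) (b, 1)).Finite := by
    refine (Set.finite_Iio n).subset fun m hm => ?_
    by_contra h
    exact hm (by simp only [hn m (not_lt.1 h), smul_zero])
  have := AddMonoidHom.map_finsum g.toAddMonoidHom hfin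
  simp only [LinearMap.toAddMonoidHom_coe, map_smul, hg'] at this
  exact congrArg Prod.fst this


/-! #### The tensor product `L ⊗ A` -/

section Tensor

variable (L : DGLA.{u, v} K) (A : NilpDGA K)

/-- The part of degree `n` of `L ⊗ A` is spanned by the `x ⊗ a` with `deg x + deg a = n`. -/
def tensorGr (n : ℤ) : Submodule K (L ⊗[K] A) :=
  Submodule.span K {t | ∃ i j : ℤ, i + j = n ∧ ∃ x ∈ L.gr i, ∃ a ∈ A.gr j, t = x ⊗ₜ a}

/-- The differential `x ⊗ a ↦ d x ⊗ a + (-1) ^ (deg x) x ⊗ d a`. -/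
noncomputable def tensorD : L ⊗[K] A →ₗ[K] L ⊗[K] A :=
  TensorProduct.map L.d LinearMap.id + TensorProduct.map (GradedSpace.parity L.gr L.isInternal) A.d

/-- The bracket `[x ⊗ a, y ⊗ b] = (-1) ^ (deg a * deg y) [x, y] ⊗ a b`, written as
`[x, y₀] ⊗ a b + [x, y₁] ⊗ ε(a) b`, where `y₀`, `y₁` are the even and the odd part of `y` and `ε` is
the parity operator; see `tensorBracket_tmul`. -/
noncomputable def tensorBracket : L ⊗[K] A →ₗ[K] L ⊗[K] A →ₗ[K] L ⊗[K] A :=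
  TensorProduct.map₂ (L.bracket.compl₂ (GradedSpace.even L.gr L.isInternal)) (LinearMap.mul K A) +
  TensorProduct.map₂ (L.bracket.compl₂ (GradedSpace.odd L.gr L.isInternal))
    (LinearMap.mul K A ∘ₗ GradedSpace.parity A.gr A.isInternal)

variable {L A}

theorem tmul_mem {i j n : ℤ} (h : i + j = n) {x : L} {a : A} (hx : x ∈ L.gr i) (ha : a ∈ A.gr j) :
    x ⊗ₜ[K] a ∈ tensorGr L A n :=
  Submodule.subset_span ⟨i, j, h, x, hx, a, ha, rfl⟩

/-- Induction over homogeneous pure tensors of fixed total degree. -/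
theorem tensorGr_induction {n : ℤ} {p : (t : L ⊗[K] A) → t ∈ tensorGr L A n → Prop}
    (tmul : ∀ i j (h : i + j = n) x (hx : x ∈ L.gr i) a (ha : a ∈ A.gr j),
      p (x ⊗ₜ a) (tmul_mem h hx ha))
    (zero : p 0 (zero_mem _))
    (add : ∀ s t hs ht, p s hs → p t ht → p (s + t) (add_mem hs ht))
    (smul : ∀ (c : K) s hs, p s hs → p (c • s) (Submodule.smul_mem _ c hs))
    {t : L ⊗[K] A} (ht : t ∈ tensorGr L A n) : p t ht := by
  induction ht using Submodule.span_induction with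
  | mem t ht =>
    obtain ⟨i, j, h, x, hx, a, ha, rfl⟩ := ht
    exact tmul i j h x hx a ha
  | zero => exact zero
  | add s t h h' hs ht => exact add s t h h' hs ht
  | smul c s h hs => exact smul c s h hs

theorem tensorD_tmul {i : ℤ} {x : L} (hx : x ∈ L.gr i) (a : A) :
    tensorD L A (x ⊗ₜ a) = L.d x ⊗ₜ a + ((-1 : K) ^ i) • (x ⊗ₜ[K] A.d a) := by
  simp [tensorD, GradedSpace.parity_apply L.isInternal hx, TensorProduct.smul_tmul']

theorem tensorBracket_tmul [CharZero K] {p j : ℤ} (x : L) {a : A} {y : L} (b : A)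
    (ha : a ∈ A.gr p) (hy : y ∈ L.gr j) :
    tensorBracket L A (x ⊗ₜ a) (y ⊗ₜ b) =
      ((-1 : K) ^ (p * j)) • (L.bracket x y ⊗ₜ[K] (a * b)) := by
  have h2 : (2⁻¹ : K) + 2⁻¹ = 1 := by norm_num
  rcases Int.even_or_odd j with hj | hj
  · simp [tensorBracket, GradedSpace.even, GradedSpace.odd, GradedSpace.parity_apply _ hy,
      GradedSpace.parity_apply _ ha, hj.neg_one_zpow, (hj.mul_left p).neg_one_zpow,
      ← add_smul, h2, smul_add]
  · have hpj : (-1 : K) ^ (p * j) = (-1) ^ p := by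
      rw [mul_comm, zpow_mul, hj.neg_one_zpow]
    simp [tensorBracket, GradedSpace.even, GradedSpace.odd, GradedSpace.parity_apply _ hy,
      GradedSpace.parity_apply _ ha, hj.neg_one_zpow, hpj,
      ← add_smul, h2, smul_add]

theorem sign_eq {m n : ℤ} (k : ℤ) (h : m = n + 2 * k) : (-1 : K) ^ m = (-1) ^ n := by
  rw [h, zpow_add₀ (by simp), zpow_mul]
  norm_num

theorem tensor_isInternal : DirectSum.IsInternal (tensorGr L A) := by
  let p : ℤ → L ⊗[K] A →ₗ[K] L ⊗[K] A := fun n =>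
    TensorProduct.lift (DirectSum.toModule K ℤ (A →ₗ[K] L ⊗[K] A) (fun i =>
      (TensorProduct.mk K L A).compl₂ (GradedSpace.proj A.gr A.isInternal (n - i)) ∘ₗ
        (L.gr i).subtype) ∘ₗ (GradedSpace.decomp L.gr L.isInternal).toLinearMap)
  have hp : ∀ n i (x : L) (a : A), x ∈ L.gr i →
      p n (x ⊗ₜ a) = x ⊗ₜ GradedSpace.proj A.gr A.isInternal (n - i) a := by
    intro n i x a hx
    simp [p, GradedSpace.decomp_apply _ hx]
  refine GradedSpace.isInternal_of_proj p (fun n m t ht => ?_) ?_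
  · induction ht using tensorGr_induction with
    | tmul i j h x hx a ha =>
      rw [hp n i x a hx, GradedSpace.proj_apply _ ha]
      by_cases hnm : n = m
      · have : n - i = j := by omega
        simp [hnm, ← h]
      · have : n - i ≠ j := by omega
        simp [hnm, this]
    | zero => simp
    | add s t _ _ hs ht => rw [map_add, hs, ht]; split_ifs <;> simp
    | smul c s _ hs => rw [map_smul, hs]; split_ifs <;> simp
  · rw [eq_top_iff]
    rintro t -
    induction t using TensorProduct.induction_on with
    | zero => exact zero_mem _
    | add s t hs ht => exact add_mem hs ht
    | tmul x a =>
      induction x using GradedSpace.induction L.isInternal with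
      | add x y hx hy => rw [TensorProduct.add_tmul]; exact add_mem hx hy
      | hom i x hx =>
        induction a using GradedSpace.induction A.isInternal with
        | add a b ha hb => rw [TensorProduct.tmul_add]; exact add_mem ha hb
        | hom j a ha => exact Submodule.mem_iSup_of_mem (i + j) (tmul_mem rfl hx ha)

variable (L A) in
/-- The differential graded Lie algebra `L ⊗ A`. -/
noncomputable abbrev tensor [CharZero K] : DGLA.{u, max v u} K where
  carrier := L ⊗[K] A
  gr := tensorGr L A
  isInternal := tensor_isInternal
  d := tensorD L A
  bracket := tensorBracket L A
  d_mem {n t} ht := by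
    induction ht using tensorGr_induction with
    | zero => simp
    | add s t _ _ hs ht => rw [map_add]; exact add_mem hs ht
    | smul c s _ hs => rw [map_smul]; exact Submodule.smul_mem _ _ hs
    | tmul i j h x hx a ha =>
      rw [tensorD_tmul hx]
      exact add_mem (tmul_mem (by omega) (L.d_mem hx) ha)
        (Submodule.smul_mem _ _ (tmul_mem (by omega) hx (A.d_mem ha)))
  d_d t := by
    induction t using TensorProduct.induction_on with
    | zero => simp
    | add s t hs ht => simp [hs, ht]
    | tmul x a =>
      induction x using GradedSpace.induction L.isInternal with
      | add x y hx hy => simp [TensorProduct.add_tmul, hx, hy]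
      | hom i x hx =>
        rw [tensorD_tmul hx, map_add, map_smul, tensorD_tmul hx, tensorD_tmul (L.d_mem hx),
          L.d_d, A.d_d]
        rw [zpow_add₀ (by simp)]
        simp
  bracket_mem {m n s t} hs ht := by
    induction hs using tensorGr_induction with
    | zero => simp
    | add s s' _ _ hs hs' => simpa using add_mem hs hs'
    | smul c s _ hs => simpa using Submodule.smul_mem _ c hs
    | tmul i p h x hx a ha =>
      induction ht using tensorGr_induction with
      | zero => simp
      | add s s' _ _ hs hs' => simpa using add_mem hs hs'
      | smul c s _ hs => simpa using Submodule.smul_mem _ c hs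
      | tmul j q h' y hy b hb =>
        rw [tensorBracket_tmul _ _ ha hy]
        exact Submodule.smul_mem _ _
          (tmul_mem (by omega) (L.bracket_mem hx hy) (A.mul_mem ha hb))
  skew {m n s t} hs ht := by
    induction hs using tensorGr_induction with
    | zero => simp
    | add s s' _ _ hs hs' =>
      simp only [map_add, LinearMap.add_apply, smul_add]
      rw [add_add_add_comm, hs, hs', add_zero]
    | smul c s _ hs =>
      simp only [map_smul, LinearMap.smul_apply]
      rw [smul_comm, ← smul_add, hs, smul_zero]
    | tmul i p h x hx a ha =>
      induction ht using tensorGr_induction with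
      | zero => simp
      | add s s' _ _ hs hs' =>
        simp only [map_add, LinearMap.add_apply, smul_add]
        rw [add_add_add_comm, hs, hs', add_zero]
      | smul c s _ hs =>
        simp only [map_smul, LinearMap.smul_apply]
        rw [smul_comm, ← smul_add, hs, smul_zero]
      | tmul j q h' y hy b hb =>
        rw [tensorBracket_tmul _ _ ha hy, tensorBracket_tmul _ _ hb hx,
          eq_neg_of_add_eq_zero_left (L.skew hx hy), A.mul_comm ha hb, ← h, ← h']
        simp only [TensorProduct.neg_tmul, ← TensorProduct.smul_tmul', TensorProduct.tmul_smul,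
          smul_neg, smul_smul]
        rw [← neg_smul, ← add_smul]
        simp only [← zpow_add₀ (neg_ne_zero.2 (one_ne_zero (α := K)))]
        rw [sign_eq (m := p * j + (p * q + i * j)) (n := (i + p) * (j + q) + q * i) (-(i * q))
          (by ring), neg_add_cancel, zero_smul]
  jacobi {m n l r s t} hr hs ht := by
    induction hr using tensorGr_induction with
    | zero => simp
    | add r r' _ _ h h' =>
      simp only [map_add, LinearMap.add_apply, smul_add, h, h']
      abel
    | smul c r _ h =>
      simp only [map_smul, LinearMap.smul_apply, h, smul_add]
      rw [smul_comm]
    | tmul i p h1 x hx a ha =>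
      induction hs using tensorGr_induction with
      | zero => simp
      | add r r' _ _ h h' =>
        simp only [map_add, LinearMap.add_apply, smul_add, h, h']
        abel
      | smul c r _ h =>
        simp only [map_smul, LinearMap.smul_apply, h, smul_add]
        rw [smul_comm]
      | tmul j q h2 y hy b hb =>
        induction ht using tensorGr_induction with
        | zero => simp
        | add r r' _ _ h h' =>
          simp only [map_add, smul_add, h, h']
          abel
        | smul c r _ h =>
          simp only [map_smul, h, smul_add]
          rw [smul_comm]
        | tmul k r h3 z hz c hc =>
          rw [tensorBracket_tmul _ _ hb hz, tensorBracket_tmul _ _ ha hy,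
            tensorBracket_tmul _ _ ha hz]
          simp only [map_smul, LinearMap.smul_apply]
          rw [tensorBracket_tmul _ _ ha (L.bracket_mem hy hz),
            tensorBracket_tmul _ _ (A.mul_mem ha hb) hz,
            tensorBracket_tmul _ _ hb (L.bracket_mem hx hz), L.jacobi hx hy hz,
            ← mul_assoc b a c, A.mul_comm hb ha, smul_mul_assoc, mul_assoc]
          subst h1 h2
          simp only [TensorProduct.add_tmul, ← TensorProduct.smul_tmul', TensorProduct.tmul_smul,
            smul_add, smul_smul]
          congr 1
          · congr 1
            simp only [← zpow_add₀ (neg_ne_zero.2 (one_ne_zero (α := K)))]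
            exact sign_eq 0 (by ring)
          · congr 1
            simp only [← zpow_add₀ (neg_ne_zero.2 (one_ne_zero (α := K)))]
            exact sign_eq (-(i * q + p * q)) (by ring)
  leibniz {m n s t} hs ht := by
    induction hs using tensorGr_induction with
    | zero => simp
    | add r r' _ _ h h' =>
      simp only [map_add, LinearMap.add_apply, smul_add, h, h']
      abel
    | smul c r _ h =>
      simp only [map_smul, LinearMap.smul_apply, h, smul_add]
      rw [smul_comm]
    | tmul i p h1 x hx a ha =>
      induction ht using tensorGr_induction with
      | zero => simp
      | add r r' _ _ h h' =>
        simp only [map_add, smul_add, h, h']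
        abel
      | smul c r _ h =>
        simp only [map_smul, h, smul_add]
        rw [smul_comm c]
      | tmul j q h2 y hy b hb =>
        rw [tensorBracket_tmul _ _ ha hy, map_smul, tensorD_tmul (L.bracket_mem hx hy),
          tensorD_tmul hx, tensorD_tmul hy, L.leibniz hx hy, A.d_mul b ha]
        simp only [map_add, LinearMap.add_apply, map_smul, LinearMap.smul_apply]
        rw [tensorBracket_tmul _ _ ha hy, tensorBracket_tmul _ _ (A.d_mem ha) hy,
          tensorBracket_tmul _ _ ha (L.d_mem hy), tensorBracket_tmul _ _ ha hy]
        subst h1 h2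
        simp only [TensorProduct.add_tmul, TensorProduct.tmul_add, ← TensorProduct.smul_tmul',
          TensorProduct.tmul_smul, smul_add, smul_smul]
        simp only [← zpow_add₀ (neg_ne_zero.2 (one_ne_zero (α := K)))]
        rw [sign_eq (m := i + (p + 1) * j) (n := p * j + (i + j)) 0 (by ring),
          sign_eq (m := i + p + p * (j + 1)) (n := p * j + i) p (by ring),
          sign_eq (m := i + p + (j + p * j)) (n := p * j + (i + j + p)) 0 (by ring)]
        abel

/-- The filtration of `L ⊗ A` by the powers of `A`. -/
def tensorPow (L : DGLA.{u, v} K) (A : NilpDGA K) (n : ℕ) : Submodule K (L ⊗[K] A) :=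
  Submodule.span K {t | ∃ x : L, ∃ a ∈ algPow K A n, t = x ⊗ₜ a}

theorem tensorBracket_mem_pow (s t : L ⊗[K] A) (n : ℕ) (ht : t ∈ tensorPow L A n) :
    tensorBracket L A s t ∈ tensorPow L A (n + 1) := by
  induction s using TensorProduct.induction_on with
  | zero => simp
  | add s s' h h' => simpa using add_mem h h'
  | tmul x a =>
    induction ht using Submodule.span_induction with
    | zero => simp
    | add t t' _ _ h h' => simpa using add_mem h h'
    | smul c t _ h => simpa using Submodule.smul_mem _ c h
    | mem t ht =>
      obtain ⟨y, b, hb, rfl⟩ := ht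
      have h : ∀ (z : L) (c : A), z ⊗ₜ[K] (c * b) ∈ tensorPow L A (n + 1) := fun z c =>
        Submodule.subset_span ⟨z, c * b, Submodule.subset_span ⟨c, b, hb, rfl⟩, rfl⟩
      exact add_mem (h _ _) (h _ _)

theorem mem_tensorPow_zero (t : L ⊗[K] A) : t ∈ tensorPow L A 0 := by
  induction t using TensorProduct.induction_on with
  | zero => simp
  | add s s' h h' => exact add_mem h h'
  | tmul x a => exact Submodule.subset_span ⟨x, a, trivial, rfl⟩

/-- The operators `[a, ·]_d` are nilpotent on `(L ⊗ A)_d`, uniformly in `a`. -/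
theorem tensor_adExt_nilpotent [CharZero K] (L : DGLA.{u, v} K) (A : NilpDGA K) :
    ∃ n, ∀ (a : L.tensor A) (p : L.tensor A × K), ∀ m, n ≤ m →
      (((L.tensor A).adExt a) ^ m) p = 0 := by
  obtain ⟨n, hn⟩ := A.nilpotent
  have key : ∀ (a : L.tensor A) (p : L.tensor A × K) (m : ℕ),
      ((((L.tensor A).adExt a) ^ (m + 1)) p).1 ∈ tensorPow L A m ∧
        ((((L.tensor A).adExt a) ^ (m + 1)) p).2 = 0 := by
    intro a p m
    induction m with
    | zero => exact ⟨mem_tensorPow_zero _, by rw [zero_add, pow_one]; rfl⟩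
    | succ m ih =>
      rw [pow_succ' _ (m + 1), Module.End.mul_apply]
      generalize (((L.tensor A).adExt a) ^ (m + 1)) p = q at ih
      obtain ⟨q, β⟩ := q
      obtain ⟨h1, h2⟩ := ih
      dsimp only at h1 h2
      subst h2
      rw [adExt_apply, zero_smul, sub_zero]
      exact ⟨tensorBracket_mem_pow a q m h1, rfl⟩
  have hbot : tensorPow L A n = ⊥ := by
    rw [eq_bot_iff]
    refine Submodule.span_le.2 ?_
    rintro _ ⟨x, a, ha, rfl⟩
    rw [hn] at ha
    rw [(Submodule.mem_bot K).1 ha, TensorProduct.tmul_zero]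
    exact zero_mem _
  refine ⟨n + 1, fun a p m hm => ?_⟩
  obtain ⟨k, rfl⟩ := Nat.exists_eq_add_of_le hm
  have h : (((L.tensor A).adExt a) ^ (n + 1)) (((L.tensor A).adExt a ^ k) p) = 0 := by
    obtain ⟨h1, h2⟩ := key a (((L.tensor A).adExt a ^ k) p) n
    rw [hbot] at h1
    exact Prod.ext h1 h2
  rw [pow_add, Module.End.mul_apply, h]

theorem lTensor_mem {B : NilpDGA K} (f : A ⟶ B) {n : ℤ} {t : L ⊗[K] A}
    (ht : t ∈ tensorGr L A n) :
    LinearMap.lTensor L (NilpDGA.Hom.lin f) t ∈ tensorGr L B n := by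
  induction ht using tensorGr_induction with
  | zero => simp
  | add s t _ _ h h' => rw [map_add]; exact add_mem h h'
  | smul c s _ h => rw [map_smul]; exact Submodule.smul_mem _ _ h
  | tmul i j h x hx a ha =>
    rw [LinearMap.lTensor_tmul]
    exact tmul_mem h hx (NilpDGA.lin_mem f ha)

theorem lTensor_d {B : NilpDGA K} (f : A ⟶ B) (t : L ⊗[K] A) :
    LinearMap.lTensor L (NilpDGA.Hom.lin f) (tensorD L A t) =
      tensorD L B (LinearMap.lTensor L (NilpDGA.Hom.lin f) t) := by
  induction t using TensorProduct.induction_on with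
  | zero => simp
  | add s t h h' => simp only [map_add, h, h']
  | tmul x a => simp [tensorD, NilpDGA.lin_d]

theorem lTensor_bracket [CharZero K] {B : NilpDGA K} (f : A ⟶ B) (s t : L ⊗[K] A) :
    LinearMap.lTensor L (NilpDGA.Hom.lin f) (tensorBracket L A s t) =
      tensorBracket L B (LinearMap.lTensor L (NilpDGA.Hom.lin f) s)
        (LinearMap.lTensor L (NilpDGA.Hom.lin f) t) := by
  induction s using TensorProduct.induction_on with
  | zero => simp
  | add s t h h' => simp only [map_add, LinearMap.add_apply, h, h']
  | tmul x a =>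
    induction t using TensorProduct.induction_on with
    | zero => simp
    | add s t h h' => simp only [map_add, h, h']
    | tmul y b =>
      induction a using GradedSpace.induction A.isInternal with
      | add a a' h h' =>
        simp only [TensorProduct.tmul_add, map_add, LinearMap.add_apply, h, h']
      | hom p a ha =>
        induction y using GradedSpace.induction L.isInternal with
        | add y y' h h' => simp only [TensorProduct.add_tmul, map_add, h, h']
        | hom j y hy =>
          rw [tensorBracket_tmul _ _ ha hy, map_smul]
          simp only [LinearMap.lTensor_tmul]
          rw [tensorBracket_tmul _ _ (NilpDGA.lin_mem f ha) hy, NilpDGA.lin_mul]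

/-- The morphism `L ⊗ A → L ⊗ B` induced by a morphism `A → B`. -/
noncomputable def tensorMap [CharZero K] (L : DGLA.{u, v} K) {A B : NilpDGA K} (f : A ⟶ B) :
    Hom (L.tensor A) (L.tensor B) where
  lin := LinearMap.lTensor L (NilpDGA.Hom.lin f)
  map_gr ht := lTensor_mem f ht
  map_d t := lTensor_d f t
  map_bracket s t := lTensor_bracket f s t

/-- The functor `Def_L`: Maurer-Cartan elements of `L ⊗ A` modulo the gauge transformations
`e ^ a`, `a` in `(L ⊗ A)^0`. `Quot` divides by the equivalence relation generated by `GaugeRel`, so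
the classes are the orbits of the group of all gauge transformations `exp ((L ⊗ A)^0)`. -/
noncomputable def Def [CharZero K] (L : DGLA.{u, v} K) : NilpDGA K ⥤ Type (max v u) where
  obj A := Quot (L.tensor A).GaugeRel
  map {A B} f := ↾ Quot.map (L.tensorMap f).mapMC (by
    rintro x y ⟨a, ha, h⟩
    refine ⟨(L.tensorMap f).lin a, (L.tensorMap f).map_gr ha, ?_⟩
    obtain ⟨n, hn⟩ := tensor_adExt_nilpotent L A
    rw [show ((L.tensorMap f).mapMC y).1 = (L.tensorMap f).lin y.1 from rfl, h]
    exact (L.tensorMap f).map_gauge a x.1 ⟨n, hn a _⟩)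
  map_id A := by
    ext x
    induction x using Quot.ind with
    | mk x =>
      refine congrArg (Quot.mk _) (Subtype.ext ?_)
      exact LinearMap.congr_fun (LinearMap.lTensor_id L A) x.1
  map_comp f g := by
    ext x
    induction x using Quot.ind with
    | mk x =>
      refine congrArg (Quot.mk _) (Subtype.ext ?_)
      exact LinearMap.congr_fun
        (LinearMap.lTensor_comp L (NilpDGA.Hom.lin g) (NilpDGA.Hom.lin f)) x.1

end Tensor

end DGLA

/-! Inside `L_d = L ⊕ K d` a Maurer–Cartan element `x` becomes an element `x + d` of square zero,
and the gauge action becomes the exponential of the nilpotent derivation `[a, ·]_d`. Hence the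
action preserves the Maurer–Cartan equation, `e ^ (-a)` undoes `e ^ a`, and `[x + d, k] = d k + [x,
k]` stabilizes `x` for every `k` of degree `-1`.

The tensor product with `L` is exact over a field, so `L ⊗ (A ×_C B)` is the fibre product of `L ⊗
A` and `L ⊗ B`, and a surjection `A → C` lets gauge parameters be lifted. Two classes that agree
over `C` therefore have representatives that agree over `C`, which glue: this is surjectivity of the
comparison map. For an acyclic small extension the kernel of `L ⊗ A → L ⊗ B` is central and acyclic
(`exists_primitive`). By Bianchi's identity the curvature of a lift is then a coboundary in the
kernel, so a Maurer–Cartan element lifts; two lifts differ by a coboundary `d u`, so they are gauge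
equivalent.

The delicate point is injectivity of the comparison map when `C` is acyclic with zero multiplication
(`comparison_injective`). Parameters `a`, `b` relating the two components need not agree in `L ⊗ C`.
There gauge acts by `x ↦ x - d a`, so the discrepancy is a cocycle, hence `d h`. A lift `k` of `h`
gives a stabilizer `s = d k + [x, k]` of the first component, whose image is exactly the
discrepancy, and `e ^ a e ^ s` can be used in place of `e ^ a`.

The full Baker–Campbell–Hausdorff formula is not needed: it suffices that `e ^ a e ^ b` equals `e ^
(a + b)` preceded on the left by exponentials with parameters in `L ⊗ A ^ 2` (`exists_gauge_gauge`),
because those parameters vanish in `L ⊗ C`. This follows from the weak Zassenhaus formula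
`GradedExp.exp_mul_exp`, obtained from a differential equation for polynomials with coefficients in
the operator ring.

On `K[i - 1]` all brackets vanish, so Maurer–Cartan elements are the `z ⊗ 1` with `d z = 0`, and
gauge equivalence is congruence modulo coboundaries. -/

/-! ### Products of exponentials in a nilpotent Lie algebra of operators -/

namespace GradedExp

open Polynomial IsNilpotent

variable {E : Type*} [Ring E]

/-- The Euler operator `X d/dX` on polynomials with noncommutative coefficients. -/
noncomputable def euler (p : E[X]) : E[X] := X * derivative p

/-- Unlike `d/dX`, the Euler operator does not shift degrees, so it is compatible with the condition
that the `n`-th coefficient lie in `F n`. -/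
theorem coeff_euler (p : E[X]) (n : ℕ) : (euler p).coeff n = n • p.coeff n := by
  cases n with
  | zero => simp [euler]
  | succ n => rw [euler, coeff_X_mul, coeff_derivative, nsmul_eq_mul, ← Nat.cast_succ,
      (Nat.cast_commute _ _).eq]

theorem euler_mul (p q : E[X]) : euler (p * q) = euler p * q + p * euler q := by
  rw [euler, euler, euler, derivative_mul, mul_add, ← mul_assoc, ← mul_assoc, ← mul_assoc,
    (commute_X p).eq]

theorem eval_one_mul (p q : E[X]) : (p * q).eval 1 = p.eval 1 * q.eval 1 :=
  eval₂_mul_noncomm _ _ fun _ => Commute.one_right _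

/-- Evaluation at `1`. -/
noncomputable def evalOne : E[X] →+* E where
  toFun p := p.eval 1
  map_one' := eval_one
  map_mul' := eval_one_mul
  map_zero' := eval_zero
  map_add' _ _ := eval_add

theorem isNilpotent_monomial (k : ℕ) {c : E} (hc : IsNilpotent c) :
    IsNilpotent (monomial k c) := by
  obtain ⟨n, hn⟩ := hc
  exact ⟨n, by rw [monomial_pow, hn, monomial_zero_right]⟩

theorem euler_monomial (k : ℕ) (c : E) : euler (monomial k c) = k • monomial k c := by
  ext n
  rw [coeff_euler, coeff_smul, coeff_monomial]
  split_ifs with h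
  · rw [h]
  · simp

variable [Algebra ℚ E]

/-- A monomial `c X ^ k` commutes with its own derivative, so its exponential has the usual
logarithmic derivative even though the coefficient ring is noncommutative. -/
theorem euler_exp_monomial (k : ℕ) {c : E} (hc : IsNilpotent c) :
    euler (exp (monomial k c)) = euler (monomial k c) * exp (monomial k c) := by
  obtain ⟨n, hn⟩ := isNilpotent_monomial k hc
  -- One power beyond nilpotency: after differentiation the sum over `range (n + 1)` loses its
  -- constant term and is reindexed as the sum over `range n` on the other side.
  have hn' : (monomial k c) ^ (n + 1) = 0 := by rw [_root_.pow_succ, hn, zero_mul]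
  have hpow : ∀ m, euler ((monomial k c) ^ m) = (m * k) • (monomial k c) ^ m := fun m => by
    rw [monomial_pow, euler_monomial, mul_comm]
  have hlin : ∀ (q : ℕ → ℚ) (s : Finset ℕ) (f : ℕ → E[X]),
      euler (∑ i ∈ s, q i • f i) = ∑ i ∈ s, q i • euler (f i) := fun q s f => by
    simp [euler, Finset.mul_sum]
  rw [exp_eq_sum hn', hlin, Finset.sum_range_succ', ← exp_eq_sum hn', exp_eq_sum hn,
    Finset.mul_sum]
  simp only [hpow]
  rw [zero_mul, zero_smul, smul_zero, add_zero]
  refine Finset.sum_congr rfl fun m _ => ?_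
  rw [euler_monomial, pow_succ', mul_smul_comm, smul_mul_assoc, mul_smul,
    ← Nat.cast_smul_eq_nsmul ℚ (m + 1), smul_smul, Nat.factorial_succ, Nat.cast_mul, mul_inv,
    mul_comm (_⁻¹), mul_assoc, inv_mul_cancel₀ (by positivity), mul_one]

/-- An exponential series of left and right multiplications is a conjugation. -/
theorem exp_mulLeft_sub_mulRight {R : Type*} [Ring R] [Algebra ℚ R] {w : R} (hw : IsNilpotent w)
    (p : R) : exp (LinearMap.mulLeft ℚ w - LinearMap.mulRight ℚ w) p = exp w * p * exp (-w) := by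
  obtain ⟨n, hn⟩ := hw
  have h1 : (LinearMap.mulLeft ℚ w) ^ n = 0 := by
    rw [LinearMap.pow_mulLeft, hn, LinearMap.mulLeft_zero_eq_zero]
  have hn' : (-w) ^ n = 0 := by rw [neg_pow, hn, mul_zero]
  have h2 : (LinearMap.mulRight ℚ (-w)) ^ n = 0 := by
    rw [LinearMap.pow_mulRight, hn', LinearMap.mulRight_zero_eq_zero]
  have h3 : LinearMap.mulLeft ℚ w - LinearMap.mulRight ℚ w =
      LinearMap.mulLeft ℚ w + LinearMap.mulRight ℚ (-w) := by
    ext x; simp [sub_eq_add_neg]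
  rw [h3, exp_add_of_commute (LinearMap.commute_mulLeft_right w (-w)) ⟨n, h1⟩ ⟨n, h2⟩,
    exp_eq_sum h1, exp_eq_sum h2, exp_eq_sum hn, exp_eq_sum hn']
  simp [LinearMap.sum_apply, LinearMap.pow_mulLeft, LinearMap.pow_mulRight, Finset.sum_mul,
    Finset.mul_sum, mul_assoc]

theorem isNilpotent_mulLeft_sub_mulRight {R : Type*} [Ring R] [Algebra ℚ R] {w : R}
    (hw : IsNilpotent w) : IsNilpotent (LinearMap.mulLeft ℚ w - LinearMap.mulRight ℚ w) := by
  obtain ⟨n, hn⟩ := hw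
  refine (LinearMap.commute_mulLeft_right w w).isNilpotent_sub ⟨n, ?_⟩ ⟨n, ?_⟩
  · rw [LinearMap.pow_mulLeft, hn, LinearMap.mulLeft_zero_eq_zero]
  · rw [LinearMap.pow_mulRight, hn, LinearMap.mulRight_zero_eq_zero]

/-! ### Filtered polynomials and the weak Zassenhaus formula. -/

variable (F : ℕ → Submodule ℚ E)

/-- Polynomials of order at least `k` whose `n`-th coefficient lies in `F n`. -/
def polys (k : ℕ) : Submodule ℚ E[X] where
  carrier := {p | ∀ n, p.coeff n ∈ F n ∧ (n < k → p.coeff n = 0)}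
  add_mem' hp hq n := ⟨by rw [coeff_add]; exact add_mem (hp n).1 (hq n).1,
    fun h => by rw [coeff_add, (hp n).2 h, (hq n).2 h, add_zero]⟩
  zero_mem' n := ⟨by simp, fun _ => by simp⟩
  smul_mem' c p hp n := ⟨by rw [coeff_smul]; exact Submodule.smul_mem _ c (hp n).1,
    fun h => by rw [coeff_smul, (hp n).2 h, smul_zero]⟩

variable {F}

theorem polys_antitone {k l : ℕ} (h : k ≤ l) : polys F l ≤ polys F k :=
  fun _ hp n => ⟨(hp n).1, fun hn => (hp n).2 (by omega)⟩

theorem monomial_mem_polys {k l : ℕ} (h : l ≤ k) {c : E} (hc : c ∈ F k) :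
    monomial k c ∈ polys F l := by
  intro n
  rw [coeff_monomial]
  split_ifs with hn
  · exact ⟨hn ▸ hc, fun h' => by omega⟩
  · exact ⟨zero_mem _, fun _ => rfl⟩

/-- A finite filtration of subspaces of nilpotent elements, compatible with commutators. -/
structure IsFiltration (F : ℕ → Submodule ℚ E) : Prop where
  commutator : ∀ {i j x y}, x ∈ F i → y ∈ F j → x * y - y * x ∈ F (i + j)
  isNilpotent : ∀ {i x}, x ∈ F i → IsNilpotent x
  exists_eq_bot : ∃ N, ∀ i, N ≤ i → F i = ⊥

/-- Since `X` is central, the `n`-th coefficient of the commutator is the sum of the commutators of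
coefficients over all `i + j = n`. -/
theorem commutator_mem_polys (hF : IsFiltration F) {k l : ℕ} {p q : E[X]}
    (hp : p ∈ polys F k) (hq : q ∈ polys F l) :
    p * q - q * p ∈ polys F (k + l) := by
  intro n
  have h : (p * q - q * p).coeff n = ∑ x ∈ Finset.HasAntidiagonal.antidiagonal n,
      (p.coeff x.1 * q.coeff x.2 - q.coeff x.2 * p.coeff x.1) := by
    rw [coeff_sub, coeff_mul, coeff_mul, Finset.sum_sub_distrib,
      ← Finset.Nat.sum_antidiagonal_swap (f := fun x => q.coeff x.1 * p.coeff x.2)]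
    rfl
  rw [h]
  refine ⟨Submodule.sum_mem _ fun x hx => ?_, fun hn => Finset.sum_eq_zero fun x hx => ?_⟩
  · rw [← Finset.HasAntidiagonal.mem_antidiagonal.1 hx]
    exact hF.commutator (hp _).1 (hq _).1
  · have := Finset.HasAntidiagonal.mem_antidiagonal.1 hx
    by_cases h1 : x.1 < k
    · simp [(hp _).2 h1]
    · simp [(hq x.2).2 (by omega)]

/-- Conjugation by `exp w` is `exp (ad w)`. Subtracting `p` removes the zeroth term, and every
remaining term contains at least one commutator with `w`, which raises the order by `k`. -/
theorem conj_sub_mem_polys (hF : IsFiltration F) {k l : ℕ} {w p : E[X]}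
    (hw : w ∈ polys F k) (hn : IsNilpotent w)
    (hp : p ∈ polys F l) : exp w * p * exp (-w) - p ∈ polys F (k + l) := by
  obtain ⟨n, hn'⟩ := isNilpotent_mulLeft_sub_mulRight hn
  have hpow : ∀ i, ((LinearMap.mulLeft ℚ w - LinearMap.mulRight ℚ w) ^ (i + 1)) p ∈
      polys F (k + l) := by
    intro i
    induction i with
    | zero => simpa using commutator_mem_polys hF hw hp
    | succ i ih =>
      rw [pow_succ', Module.End.mul_apply]
      exact polys_antitone (by omega) (commutator_mem_polys hF hw ih)
  have hn'' : (LinearMap.mulLeft ℚ w - LinearMap.mulRight ℚ w) ^ (n + 1) = 0 := by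
    rw [_root_.pow_succ, hn', zero_mul]
  rw [← exp_mulLeft_sub_mulRight hn, exp_eq_sum hn'', Finset.sum_range_succ']
  simp only [LinearMap.add_apply, LinearMap.sum_apply, LinearMap.smul_apply, pow_zero,
    Nat.factorial_zero, Nat.cast_one, inv_one, one_smul, Module.End.one_apply, add_sub_cancel_right]
  exact Submodule.sum_mem _ fun i _ => Submodule.smul_mem _ _ (hpow i)

/-- A solution of `X g' = U g` is at `1` a product of exponentials. -/
theorem eval_eq_prod_exp (hF : IsFiltration F) {N : ℕ} (hN : ∀ i, N ≤ i → F i = ⊥)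
    (m : ℕ) : ∀ k, 1 ≤ k → N ≤ k + m → ∀ g U : E[X], g.coeff 0 = 1 → U ∈ polys F k → euler g = U * g →
    ∃ ws : List E, (∀ w ∈ ws, ∃ j, k ≤ j ∧ w ∈ F j) ∧ g.eval 1 = (ws.map exp).prod := by
  induction m with
  | zero =>
    intro k hk hNk g U hg hU h
    -- Below degree `k` the coefficients of `U` vanish by its order, and from degree `k ≥ N` on they
    -- lie in `F n = ⊥`. Then `n • g.coeff n = 0`, so only the constant term of `g` survives.
    have hU0 : U = 0 := by
      ext n
      by_cases hn : n < k
      · exact (hU n).2 hn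
      · have := (hU n).1
        rw [hN n (by omega)] at this
        exact (Submodule.mem_bot ℚ).1 this
    have hg1 : g = 1 := by
      ext n
      cases n with
      | zero => simpa using hg
      | succ n =>
        have h1 := coeff_euler g (n + 1)
        rw [h, hU0, zero_mul, coeff_zero, ← Nat.cast_smul_eq_nsmul ℚ, eq_comm,
          smul_eq_zero] at h1
        rw [h1.resolve_left (by positivity), coeff_one, if_neg (by omega)]
    exact ⟨[], by simp, by simp [hg1]⟩
  | succ m ih =>
    intro k hk hNk g U hg hU h
    have hcF := (hU k).1
    -- Chosen so that `euler (c X ^ k)` is the lowest term of `U`; splitting `exp (c X ^ k)` off `g`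
    -- on the left then cancels that term.
    set c := (k : ℚ)⁻¹ • U.coeff k with hc
    have hcF' : c ∈ F k := Submodule.smul_mem _ _ hcF
    have hcn := hF.isNilpotent hcF'
    have hwn := isNilpotent_monomial k hcn
    have hwn' := isNilpotent_monomial k hcn.neg
    have hk0 : (k : ℚ) ≠ 0 := by positivity
    have hw : euler (monomial k c) = monomial k (U.coeff k) := by
      rw [euler_monomial, hc, ← Nat.cast_smul_eq_nsmul ℚ, smul_monomial, smul_smul,
        mul_inv_cancel₀ hk0, one_smul]
    have hw' : euler (monomial k (-c)) = - monomial k (U.coeff k) := by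
      rw [euler_monomial, map_neg, smul_neg, ← euler_monomial, hw]
    have e1 : exp (monomial k c) * exp (monomial k (-c)) = 1 := by
      rw [map_neg]; exact exp_mul_exp_neg_self hwn
    have h0 : (exp (monomial k (-c)) * g).coeff 0 = 1 := by
      have := map_exp hwn' (constantCoeff (R := E))
      rw [constantCoeff_apply, constantCoeff_apply, coeff_monomial, if_neg (by omega),
        exp_zero] at this
      rw [mul_coeff_zero, this, hg, one_mul]
    -- This is the logarithmic derivative of `exp (-c X ^ k) g`. Conjugation changes `U` only in
    -- orders at least `2 k ≥ k + 1`, and the term of order `k` is subtracted.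
    have hU' : exp (monomial k (-c)) * U * exp (monomial k c) - monomial k (U.coeff k) ∈
        polys F (k + 1) := by
      have h1 : exp (monomial k (-c)) * U * exp (monomial k c) - U ∈ polys F (k + 1) := by
        have := conj_sub_mem_polys hF (monomial_mem_polys le_rfl (neg_mem hcF')) hwn' hU
        rw [← map_neg, neg_neg] at this
        exact polys_antitone (by omega) this
      have h2 : U - monomial k (U.coeff k) ∈ polys F (k + 1) := by
        intro n
        rw [coeff_sub, coeff_monomial]
        split_ifs with hn
        · subst hn
          rw [sub_self]
          exact ⟨zero_mem _, fun _ => rfl⟩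
        · rw [sub_zero]
          exact ⟨(hU n).1, fun hn' => (hU n).2 (by omega)⟩
      have := add_mem h1 h2
      rwa [sub_add_sub_cancel] at this
    have he : euler (exp (monomial k (-c)) * g) =
        (exp (monomial k (-c)) * U * exp (monomial k c) - monomial k (U.coeff k)) *
          (exp (monomial k (-c)) * g) := by
      rw [euler_mul, euler_exp_monomial k hcn.neg, hw', h, sub_mul, neg_mul, neg_mul,
        mul_assoc (monomial k _), ← sub_eq_neg_add]
      congr 1
      rw [mul_assoc _ (exp (monomial k c)), ← mul_assoc (exp (monomial k c)), e1, one_mul,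
        mul_assoc]
    obtain ⟨ws, hws, hprod⟩ := ih (k + 1) (by omega) (by omega) _ _ h0 hU' he
    refine ⟨c :: ws, ?_, ?_⟩
    · intro w hw
      rcases List.mem_cons.1 hw with rfl | hw
      · exact ⟨k, le_rfl, hcF'⟩
      · obtain ⟨j, hj, hj'⟩ := hws w hw
        exact ⟨j, by omega, hj'⟩
    · have hg' : g = exp (monomial k c) * (exp (monomial k (-c)) * g) := by
        rw [← mul_assoc, e1, one_mul]
      have hev := map_exp hwn (evalOne (E := E))
      rw [show evalOne (monomial k c) = c by simp [evalOne]] at hev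
      rw [hg', eval_one_mul, hprod, List.map_cons, List.prod_cons, ← hev]
      rfl

/-- A weak form of the Zassenhaus formula. -/
theorem exp_mul_exp (hF : IsFiltration F) {a b : E} (ha : a ∈ F 1) (hb : b ∈ F 1) :
    ∃ ws : List E, (∀ w ∈ ws, ∃ j, 2 ≤ j ∧ w ∈ F j) ∧
      exp a * exp b = (ws.map exp).prod * exp (a + b) := by
  have hab := add_mem ha hb
  have na := hF.isNilpotent ha
  have nb := hF.isNilpotent hb
  have nab := hF.isNilpotent hab
  have np := isNilpotent_monomial 1 na
  have nq := isNilpotent_monomial 1 nb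
  have nr := isNilpotent_monomial 1 nab
  have hev : ∀ c : E, IsNilpotent c → (exp (monomial 1 c)).eval 1 = exp c := fun c hc => by
    have := map_exp (isNilpotent_monomial 1 hc) (evalOne (E := E))
    rwa [show evalOne (monomial 1 c) = c by simp [evalOne]] at this
  have hco : ∀ c : E, IsNilpotent c → (exp (monomial 1 c)).coeff 0 = 1 := fun c hc => by
    have := map_exp (isNilpotent_monomial 1 hc) (constantCoeff (R := E))
    rwa [constantCoeff_apply, constantCoeff_apply, coeff_monomial, if_neg (by omega),
      exp_zero] at this
  have hp := monomial_mem_polys le_rfl ha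
  have hq := monomial_mem_polys le_rfl hb
  have hr := monomial_mem_polys le_rfl hab
  have eul : ∀ c : E, IsNilpotent c →
      euler (exp (monomial 1 c)) = monomial 1 c * exp (monomial 1 c) := fun c hc => by
    rw [euler_exp_monomial 1 hc, euler_monomial, one_smul]
  have hsum : monomial 1 (a + b) = monomial 1 a + monomial 1 b := map_add _ _ _
  have ea := eul a na
  have eb := eul b nb
  have er := eul _ nab.neg
  rw [map_neg] at er
  have ca := hco a na
  have cb := hco b nb
  have cr := hco _ nab.neg
  rw [map_neg] at cr
  have iP := exp_neg_mul_exp_self np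
  have iQ := exp_neg_mul_exp_self nq
  have va := hev a na
  have vb := hev b nb
  have vr := hev _ nab.neg
  rw [map_neg] at vr
  -- With `p = a X`, `q = b X`, `r = p + q`, this is the logarithmic derivative of `e ^ p e ^ q e ^
  -- (-r)`. Its linear part is `p + q - r = 0`, so the order is at least two; the proof writes it as
  -- a combination of differences between conjugates and the original elements.
  have key : monomial 1 a + exp (monomial 1 a) * monomial 1 b * exp (-monomial 1 a) -
      exp (monomial 1 a) * (exp (monomial 1 b) * monomial 1 (a + b) * exp (-monomial 1 b)) *
        exp (-monomial 1 a) ∈ polys F 2 := by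
    have h1 := conj_sub_mem_polys hF hp np hq
    have h2 := conj_sub_mem_polys hF hq nq hr
    have h3 := conj_sub_mem_polys hF hp np h2
    have h4 := conj_sub_mem_polys hF hp np hr
    have h5 := sub_mem (sub_mem (sub_mem h1 (polys_antitone (by omega) h3)) h4) h2
    convert h5 using 1
    rw [hsum]
    noncomm_ring
  -- The exponentials become opaque letters: the remaining identity uses only their Euler
  -- derivatives and the inverse relations.
  generalize monomial 1 a = p at *
  generalize monomial 1 b = q at *
  generalize monomial 1 (a + b) = r at *
  generalize exp (-r) = R' at *
  generalize exp p = P at *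
  generalize exp q = Q at *
  generalize exp (-p) = P' at *
  generalize exp (-q) = Q' at *
  obtain ⟨N, hN⟩ := hF.exists_eq_bot
  obtain ⟨ws, hws, h⟩ := eval_eq_prod_exp hF hN N 2 (by omega) (by omega) (P * Q * R') _
    (by rw [mul_coeff_zero, mul_coeff_zero, ca, cb, cr, one_mul, one_mul]) key (by
      have hP : ∀ x, P' * (P * x) = x := fun x => by rw [← mul_assoc, iP, one_mul]
      have hQ : ∀ x, Q' * (Q * x) = x := fun x => by rw [← mul_assoc, iQ, one_mul]
      rw [euler_mul, euler_mul, ea, eb, er]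
      simp only [sub_mul, add_mul, mul_assoc, hP, hQ, neg_mul, mul_neg]
      abel)
  refine ⟨ws, hws, ?_⟩
  rw [eval_one_mul, eval_one_mul, va, vb, vr] at h
  rw [← h, mul_assoc, exp_neg_mul_exp_self nab, mul_one]

end GradedExp

/-! ### Gauge transformations as exponentials -/

/-- The exponential of a nilpotent derivation of a bilinear map. -/
theorem exp_bilin_of_derivation {R V : Type*} [CommRing R] [AddCommGroup V] [Module R V]
    [Module ℚ V] (q : V →ₗ[R] V →ₗ[R] V) (D : Module.End R V)
    (hD : ∀ x y, D (q x y) = q x (D y) + q (D x) y) (hn : IsNilpotent D) (x y : V) :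
    IsNilpotent.exp D (q x y) = q (IsNilpotent.exp D x) (IsNilpotent.exp D y) := by
  -- The bilinear map is taken as the multiplication of a non-associative ring, for which the
  -- exponential of a nilpotent derivation is multiplicative.
  let _ : NonUnitalNonAssocRing V :=
    { (inferInstance : AddCommGroup V) with
      mul := fun x y => q x y
      left_distrib := fun x y z => map_add (q x) y z
      right_distrib := fun x y z => LinearMap.map_add₂ q x y z
      zero_mul := fun x => LinearMap.map_zero₂ q x
      mul_zero := fun x => map_zero (q x) }
  have : SMulCommClass R V V := ⟨fun c x y => (map_smul (q x) c y).symm⟩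
  have : IsScalarTower R V V := ⟨fun c x y => LinearMap.map_smul₂ q c x y⟩
  exact Module.End.exp_mul_of_derivation R V D hD hn x y

/-- `IsNilpotent.exp` is written with rational scalars, `gauge` with scalars in `K`; this reconciles
them. -/
theorem exp_eq_sum_smul (K : Type*) {E : Type*} [Field K] [CharZero K] [Ring E] [Algebra K E]
    [Module ℚ E] {a : E} {n : ℕ} (ha : a ^ n = 0) :
    IsNilpotent.exp a = ∑ m ∈ Finset.range n, ((m.factorial : K)⁻¹) • a ^ m := by
  rw [IsNilpotent.exp_eq_sum ha]
  refine Finset.sum_congr rfl fun m _ => ?_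
  rw [← Rat.cast_smul_eq_qsmul K, Rat.cast_inv, Rat.cast_natCast]

namespace DGLA

variable {K : Type u} [Field K] (M : DGLA.{u, v} K)

/-- For `a` of degree zero the Koszul signs are trivial, so the identity extends additively to
inhomogeneous arguments. The same applies to the next two lemmas. -/
theorem jacobi_left {a : M} (ha : a ∈ M.gr 0) (x y : M) :
    M.bracket a (M.bracket x y) = M.bracket (M.bracket a x) y + M.bracket x (M.bracket a y) := by
  induction x using GradedSpace.induction M.isInternal with
  | add x x' h h' => simp only [map_add, LinearMap.add_apply, h, h']; abel
  | hom i x hx =>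
    induction y using GradedSpace.induction M.isInternal with
    | add x x' h h' => simp only [map_add, h, h']; abel
    | hom j y hy => simpa using M.jacobi ha hx hy

theorem d_bracket_left {a : M} (ha : a ∈ M.gr 0) (x : M) :
    M.d (M.bracket a x) = M.bracket (M.d a) x + M.bracket a (M.d x) := by
  induction x using GradedSpace.induction M.isInternal with
  | add x x' h h' => simp only [map_add, h, h']; abel
  | hom i x hx => simpa using M.leibniz ha hx

theorem skew_left {a : M} (ha : a ∈ M.gr 0) (x : M) : M.bracket a x = - M.bracket x a := by
  induction x using GradedSpace.induction M.isInternal with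
  | add x x' h h' => simp only [map_add, LinearMap.add_apply, h, h']; abel
  | hom i x hx => simpa [add_eq_zero_iff_eq_neg] using M.skew ha hx

/-- `[a, ·]_d` is linear in `a`. -/
def adExtLin : M →ₗ[K] Module.End K (M × K) where
  toFun := M.adExt
  map_add' a b := by
    ext <;> simp [adExt, sub_eq_add_neg]
    abel
  map_smul' c a := by
    ext <;> simp [adExt]

/-- The operators `[a, ·]_d` represent the Lie algebra `M ^ 0`: on `M` this is the Jacobi identity,
on the coefficient of `d` the Leibniz rule. -/
theorem adExt_commutator {a b : M} (ha : a ∈ M.gr 0) (hb : b ∈ M.gr 0) :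
    M.adExt a * M.adExt b - M.adExt b * M.adExt a = M.adExt (M.bracket a b) := by
  refine LinearMap.ext fun p => ?_
  obtain ⟨x, β⟩ := p
  simp only [LinearMap.sub_apply, Module.End.mul_apply, adExt_apply, zero_smul, sub_zero,
    map_sub, map_smul, M.d_bracket_left ha, M.jacobi_left ha, Prod.mk_sub_mk]
  refine Prod.ext ?_ rfl
  simp only
  rw [M.skew_left hb (M.d a)]
  module

theorem adExt_neg {M : DGLA.{u, v} K} (a : M) : M.adExt (-a) = - M.adExt a := map_neg M.adExtLin a

/-- The bracket of `M ⊕ K d`, with values in `M`. -/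
noncomputable def bracketExt (M : DGLA.{u, v} K) : M × K →ₗ[K] M × K →ₗ[K] M × K :=
  -- The parity encodes the sign in `[x, d] = -(-1) ^ (deg x) d x`; there is no `[d, d]` term
  -- because `d` has square zero.
  LinearMap.mk₂ K (fun p q => (M.bracket p.1 q.1 + p.2 • M.d q.1 -
      q.2 • M.d (GradedSpace.parity M.gr M.isInternal p.1), 0))
    (fun p p' q => Prod.ext (by simp; module) (by simp))
    (fun c p q => Prod.ext (by simp; module) (by simp))
    (fun p q q' => Prod.ext (by simp; module) (by simp))
    (fun c p q => Prod.ext (by simp; module) (by simp))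

theorem bracketExt_apply (p q : M × K) : M.bracketExt p q =
    (M.bracket p.1 q.1 + p.2 • M.d q.1 -
      q.2 • M.d (GradedSpace.parity M.gr M.isInternal p.1), 0) := rfl

/-- Being a derivation of the extended bracket, `[a, ·]_d` has an exponential that preserves
brackets, hence the elements `x + d` of square zero. -/
theorem adExt_bracketExt {a : M} (ha : a ∈ M.gr 0) (p q : M × K) :
    M.adExt a (M.bracketExt p q) =
      M.bracketExt p (M.adExt a q) + M.bracketExt (M.adExt a p) q := by
  obtain ⟨x, α⟩ := p
  obtain ⟨y, β⟩ := q
  have hda : M.d a ∈ M.gr 1 := by simpa using M.d_mem ha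
  have key : ∀ x : M, M.bracket a (M.d (GradedSpace.parity M.gr M.isInternal x)) =
      M.bracket x (M.d a) +
        M.d (GradedSpace.parity M.gr M.isInternal (M.bracket a x)) := by
    intro x
    induction x using GradedSpace.induction M.isInternal with
    | add x x' h h' => simp only [map_add, LinearMap.add_apply, h, h']; abel
    | hom i x hx =>
      have h1 : M.bracket a x ∈ M.gr i := by simpa using M.bracket_mem ha hx
      have h2 := M.skew hda hx
      rw [one_mul] at h2
      have h4 : ((-1 : K) ^ i) * (-1) ^ i = 1 := by
        rw [← mul_zpow]; simp
      have h3 : M.bracket x (M.d a) = -(((-1 : K) ^ i) • M.bracket (M.d a) x) := by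
        rw [eq_neg_of_add_eq_zero_left h2, smul_neg, smul_smul, h4, one_smul, neg_neg]
      rw [GradedSpace.parity_apply _ hx, GradedSpace.parity_apply _ h1, map_smul, map_smul,
        map_smul, M.d_bracket_left ha, h3, smul_add]
      abel
  have hpa : M.d (GradedSpace.parity M.gr M.isInternal (M.d a)) = 0 := by
    rw [GradedSpace.parity_apply _ hda, map_smul, M.d_d, smul_zero]
  simp only [bracketExt_apply, adExt_apply, zero_smul, sub_zero, Prod.mk_add_mk, add_zero]
  refine Prod.ext ?_ rfl
  simp only [map_add, map_sub, map_smul, LinearMap.sub_apply, LinearMap.smul_apply, M.d_d, hpa,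
    M.jacobi_left ha, M.d_bracket_left ha, key, smul_zero, sub_zero]
  module

/-- If `[a, x] - d a` is killed by `a`, the exponential series stops after the linear term. -/
theorem gauge_eq {M : DGLA.{u, v} K} {a x : M} (h : M.bracket a (M.bracket a x - M.d a) = 0) :
    M.gauge a x = x + (M.bracket a x - M.d a) := by
  have hz : ∀ m, 2 ≤ m → ((M.adExt a) ^ m) (x, 1) = 0 := fun m hm => by
    obtain ⟨k, rfl⟩ := Nat.exists_eq_add_of_le' hm
    rw [pow_add, Module.End.mul_apply, pow_two, Module.End.mul_apply, adExt_apply, adExt_apply,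
      one_smul, h, zero_smul, sub_zero]
    exact map_zero _
  rw [gauge, finsum_eq_sum_of_support_subset (s := Finset.range 2)]
  · simp [Finset.sum_range_succ, adExt_apply]
  · intro m hm
    by_contra h'
    exact hm (by simp only; rw [hz m (not_lt.1 fun h => h' (Finset.mem_coe.2 (Finset.mem_range.2 h))), smul_zero])

/-! ### The gauge action on Maurer–Cartan elements. -/

section Exp

variable [CharZero K]

/-- A vector space over a field of characteristic zero is a rational vector space. -/
noncomputable instance : Module ℚ M := Module.compHom M (algebraMap ℚ K)

variable {M}

/-- Each `[a, ·]_d` takes values in `M`, so only the zeroth term of the series contributes to the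
coefficient of `d`, which stays `1`. -/
theorem exp_adExt_apply [Module ℚ (Module.End K (M × K))] {a : M} (ha : IsNilpotent (M.adExt a)) (x : M) :
    IsNilpotent.exp (M.adExt a) (x, 1) = (M.gauge a x, 1) := by
  obtain ⟨n, hn⟩ := ha
  have hn' : (M.adExt a) ^ (n + 1) = 0 := by rw [pow_succ, hn, zero_mul]
  have hz : ∀ m, n + 1 ≤ m → (M.adExt a) ^ m = 0 := fun m hm => pow_eq_zero_of_le hm hn'
  have h1 : ∑ᶠ m : ℕ, ((m.factorial : K)⁻¹) • ((M.adExt a) ^ m) (x, 1) =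
      ∑ m ∈ Finset.range (n + 1), ((m.factorial : K)⁻¹) • ((M.adExt a) ^ m) (x, 1) := by
    refine finsum_eq_sum_of_support_subset _ fun m hm => ?_
    by_contra h
    refine hm ?_
    simp only
    rw [hz m (by simpa using h), LinearMap.zero_apply, smul_zero]
  have h2 : IsNilpotent.exp (M.adExt a) (x, 1) =
      ∑ m ∈ Finset.range (n + 1), ((m.factorial : K)⁻¹) • ((M.adExt a) ^ m) (x, 1) := by
    rw [exp_eq_sum_smul K hn', LinearMap.sum_apply]
    rfl
  refine Prod.ext ?_ ?_
  · rw [h2, gauge, h1]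
  · rw [h2, Finset.sum_range_succ', Prod.snd_add, Prod.snd_sum, Finset.sum_eq_zero]
    · simp
    · intro m _
      rw [pow_succ', Module.End.mul_apply]
      simp [adExt]

theorem gauge_zero (x : M) : M.gauge 0 x = x := by
  have h0 : M.adExt 0 = 0 := map_zero M.adExtLin
  have h : IsNilpotent (M.adExt 0) := h0 ▸ IsNilpotent.zero
  have := exp_adExt_apply h x
  rw [h0, IsNilpotent.exp_zero] at this
  exact (congrArg Prod.fst this).symm

theorem gauge_neg_gauge {a : M} (ha : IsNilpotent (M.adExt a)) (x : M) :
    M.gauge (-a) (M.gauge a x) = x := by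
  have ha' : IsNilpotent (M.adExt (-a)) := by rw [adExt_neg]; exact ha.neg
  have h := exp_adExt_apply ha' (M.gauge a x)
  rw [← exp_adExt_apply ha, ← Module.End.mul_apply, adExt_neg, IsNilpotent.exp_neg_mul_exp_self ha,
    Module.End.one_apply] at h
  exact (congrArg Prod.fst h).symm

/-- For `x` of degree one, `[x + d, x + d] = 2 (d x + [x, x] / 2)`. -/
theorem bracketExt_self_eq_zero_iff {x : M} (hx : x ∈ M.gr 1) :
    M.bracketExt (x, 1) (x, 1) = 0 ↔ M.d x + (2⁻¹ : K) • M.bracket x x = 0 := by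
  have h : M.bracketExt (x, 1) (x, 1) = ((2 : K) • (M.d x + (2⁻¹ : K) • M.bracket x x), 0) := by
    rw [bracketExt_apply, GradedSpace.parity_apply _ hx]
    refine Prod.ext ?_ rfl
    simp only [map_smul, zpow_one, smul_add, smul_smul]
    norm_num
    rw [two_smul]
    abel
  rw [h, Prod.mk_eq_zero, smul_eq_zero]
  simp

theorem gauge_mem {a x : M} (ha : a ∈ M.gr 0) (hn : IsNilpotent (M.adExt a)) (hx : x ∈ M.gr 1) :
    M.gauge a x ∈ M.gr 1 := by
  obtain ⟨n, hn'⟩ := hn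
  have h := congrArg Prod.fst (exp_adExt_apply ⟨n, hn'⟩ x)
  have hda : M.d a ∈ M.gr 1 := by simpa using M.d_mem ha
  have hpow : ∀ m, (((M.adExt a) ^ m) (x, 1)).1 ∈ M.gr 1 := by
    intro m
    induction m with
    | zero => exact hx
    | succ m ih =>
      rw [pow_succ', Module.End.mul_apply]
      refine sub_mem ?_ (Submodule.smul_mem _ _ hda)
      simpa using M.bracket_mem ha ih
  rw [← show _ = M.gauge a x from h, exp_eq_sum_smul K hn', LinearMap.sum_apply, Prod.fst_sum]
  refine Submodule.sum_mem _ fun m _ => ?_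
  exact Submodule.smul_mem _ _ (hpow m)

/-- The gauge action on Maurer-Cartan elements. -/
noncomputable def gaugeMC (x : M.MC) (a : M) (ha : a ∈ M.gr 0) (hn : IsNilpotent (M.adExt a)) :
    M.MC :=
  ⟨M.gauge a x.1, gauge_mem ha hn x.2.1, by
    have h := exp_bilin_of_derivation M.bracketExt (M.adExt a) (adExt_bracketExt M ha) hn
      (x.1, 1) (x.1, 1)
    rw [(bracketExt_self_eq_zero_iff x.2.1).2 x.2.2, map_zero, exp_adExt_apply hn, eq_comm] at h
    exact (bracketExt_self_eq_zero_iff (gauge_mem ha hn x.2.1)).1 h⟩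

/-- The elements `d k + [x, k]` stabilize the Maurer-Cartan element `x`. -/
theorem adExt_stabilizer (x : M.MC) {k : M} (hk : k ∈ M.gr (-1)) :
    M.adExt (M.d k + M.bracket x.1 k) (x.1, 1) = 0 := by
  obtain ⟨x, hx, hmc⟩ := x
  have hdk : M.d k ∈ M.gr 0 := by simpa using M.d_mem hk
  have hxk : M.bracket x k ∈ M.gr 0 := by simpa using M.bracket_mem hx hk
  have h1 := M.leibniz hx hk
  have h2 := M.jacobi hx hx hk
  have h3 : M.d x = -((2⁻¹ : K) • M.bracket x x) := eq_neg_of_add_eq_zero_left hmc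
  rw [adExt_apply]
  refine Prod.ext ?_ rfl
  simp only [map_add, LinearMap.add_apply, M.d_d, one_smul, zero_add, Prod.fst_zero]
  rw [M.skew_left hdk, M.skew_left hxk, h1, h3]
  simp only [zpow_one, mul_one, neg_smul, one_smul, map_neg, LinearMap.neg_apply, map_smul,
    LinearMap.smul_apply] at h2 ⊢
  -- The Jacobi identity for the odd element `x`; this turns `[d x, k]`, rewritten by the
  -- Maurer–Cartan equation, into `-[x, [x, k]]`.
  have h4 : M.bracket (M.bracket x x) k = (2 : K) • M.bracket x (M.bracket x k) := by
    rw [two_smul]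
    nth_rewrite 2 [h2]
    abel
  rw [h4, smul_smul, inv_mul_cancel₀ two_ne_zero, one_smul]
  abel

end Exp

end DGLA

/-! ### Powers of a nilpotent algebra and the filtration of `L ⊗ A` -/

section Powers

variable {K : Type u} [Field K]

/-- The extra `1` is the index shift: `algPow K A i` is `A ^ (i + 1)`. -/
theorem mul_mem_algPow {A : Type v} [NonUnitalRing A] [Module K A] [IsScalarTower K A A]
    {i j : ℕ} {a b : A} (ha : a ∈ algPow K A i) (hb : b ∈ algPow K A j) :
    a * b ∈ algPow K A (i + j + 1) := by
  induction i generalizing a with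
  | zero => rw [zero_add]; exact Submodule.subset_span ⟨a, b, hb, rfl⟩
  | succ i ih =>
    induction ha using Submodule.span_induction with
    | zero => simp
    | add a a' _ _ h h' => rw [add_mul]; exact add_mem h h'
    | smul c a _ h => rw [smul_mul_assoc]; exact Submodule.smul_mem _ c h
    | mem a ha =>
      obtain ⟨a, a', ha', rfl⟩ := ha
      rw [mul_assoc, show i + 1 + j + 1 = (i + j + 1) + 1 by omega]
      exact Submodule.subset_span ⟨a, _, ih ha', rfl⟩

namespace NilpDGA

theorem parity_mul (A : NilpDGA K) (a b : A) :
    GradedSpace.parity A.gr A.isInternal (a * b) =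
      GradedSpace.parity A.gr A.isInternal a * GradedSpace.parity A.gr A.isInternal b := by
  induction a using GradedSpace.induction A.isInternal with
  | add a a' h h' => simp only [add_mul, map_add, h, h']
  | hom i a ha =>
    induction b using GradedSpace.induction A.isInternal with
    | add a a' h h' => simp only [mul_add, map_add, h, h']
    | hom j b hb =>
      rw [GradedSpace.parity_apply _ ha, GradedSpace.parity_apply _ hb,
        GradedSpace.parity_apply _ (A.mul_mem ha hb), smul_mul_smul_comm, zpow_add₀ (by simp)]

/-- Parity is multiplicative, so it preserves powers. This is needed because `tensorBracket` applies
it to the left factor in `A`. -/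
theorem parity_mem_algPow (A : NilpDGA K) {n : ℕ} {a : A} (ha : a ∈ algPow K A n) :
    GradedSpace.parity A.gr A.isInternal a ∈ algPow K A n := by
  induction n generalizing a with
  | zero => exact Submodule.mem_top
  | succ n ih =>
    induction ha using Submodule.span_induction with
    | zero => simp
    | add a a' _ _ h h' => rw [map_add]; exact add_mem h h'
    | smul c a _ h => rw [map_smul]; exact Submodule.smul_mem _ c h
    | mem a ha =>
      obtain ⟨a, b, hb, rfl⟩ := ha
      rw [parity_mul]
      exact Submodule.subset_span ⟨_, _, ih hb, rfl⟩

end NilpDGA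

end Powers

/-! ### Composition of gauge transformations modulo `L ⊗ A ^ 2`. -/

namespace DGLA

variable {K : Type u} [Field K] {L : DGLA.{u, v} K} {A : NilpDGA K}

theorem tensorPow_antitone : Antitone (tensorPow L A) := fun _ _ h =>
  Submodule.span_mono (by
    rintro _ ⟨x, a, ha, rfl⟩
    exact ⟨x, a, algPow_antitone K A h ha, rfl⟩)

theorem exists_tensorPow_eq_bot : ∃ N, ∀ n, N ≤ n → tensorPow L A n = ⊥ := by
  obtain ⟨N, hN⟩ := A.nilpotent
  refine ⟨N, fun n hn => ?_⟩
  rw [eq_bot_iff]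
  refine Submodule.span_le.2 ?_
  rintro _ ⟨x, a, ha, rfl⟩
  have := algPow_antitone K A hn ha
  rw [hN] at this
  rw [(Submodule.mem_bot K).1 this, TensorProduct.tmul_zero]
  exact zero_mem _

theorem tensorBracket_mem_tensorPow {i j : ℕ} {s t : L ⊗[K] A} (hs : s ∈ tensorPow L A i)
    (ht : t ∈ tensorPow L A j) : tensorBracket L A s t ∈ tensorPow L A (i + j + 1) := by
  induction hs using Submodule.span_induction with
  | zero => simp
  | add s s' _ _ h h' => simpa using add_mem h h'
  | smul c s _ h => simpa using Submodule.smul_mem _ c h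
  | mem s hs =>
    obtain ⟨x, a, ha, rfl⟩ := hs
    have hmem : ∀ (z : L) {c c' : A}, c ∈ algPow K A i → c' ∈ algPow K A j →
        z ⊗ₜ[K] (c * c') ∈ tensorPow L A (i + j + 1) := fun z _ _ hc hc' =>
      Submodule.subset_span ⟨z, _, mul_mem_algPow hc hc', rfl⟩
    induction ht using Submodule.span_induction with
    | zero => simp
    | add t t' _ _ h h' => simpa using add_mem h h'
    | smul c t _ h => simpa using Submodule.smul_mem _ c h
    | mem t ht =>
      obtain ⟨y, b, hb, rfl⟩ := ht
      exact add_mem (hmem _ ha hb) (hmem _ (A.parity_mem_algPow ha) hb)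

variable [CharZero K]

theorem isNilpotent_adExt (a : L.tensor A) : IsNilpotent ((L.tensor A).adExt a) := by
  obtain ⟨n, hn⟩ := tensor_adExt_nilpotent L A
  exact ⟨n, LinearMap.ext fun p => hn a p n le_rfl⟩

/-- The operators `[a, ·]_d` with `a` of degree zero, filtered by the powers of `A`. -/
noncomputable def adFiltration (L : DGLA.{u, v} K) (A : NilpDGA K) :
    ℕ → Submodule ℚ (Module.End K (L.tensor A × K))
  -- Since `tensorPow L A n` is `L ⊗ A ^ (n + 1)`, level `n + 1` of the filtration corresponds to `A
  -- ^ (n + 1)`. Level zero carries no information and is set to zero.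
  | 0 => ⊥
  | n + 1 =>
    { carrier := {D | ∃ a ∈ tensorGr L A 0, a ∈ tensorPow L A n ∧ D = (L.tensor A).adExt a}
      add_mem' := by
        rintro _ _ ⟨a, ha, ha', rfl⟩ ⟨b, hb, hb', rfl⟩
        exact ⟨a + b, add_mem ha hb, add_mem ha' hb', (map_add (L.tensor A).adExtLin a b).symm⟩
      zero_mem' := ⟨0, zero_mem _, zero_mem _, (map_zero (L.tensor A).adExtLin).symm⟩
      smul_mem' := by
        rintro c _ ⟨a, ha, ha', rfl⟩
        refine ⟨(c : K) • a, Submodule.smul_mem _ _ ha, Submodule.smul_mem _ _ ha', ?_⟩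
        rw [← Rat.cast_smul_eq_qsmul K]
        exact (map_smul (L.tensor A).adExtLin (c : K) a).symm }

theorem isFiltration_adFiltration : GradedExp.IsFiltration
    (E := Module.End K (L.tensor A × K)) (adFiltration L A) where
  commutator {i j x y} hx hy := by
    cases i with
    | zero =>
      rw [(Submodule.mem_bot ℚ).1 hx, zero_mul, mul_zero, sub_zero]
      exact zero_mem _
    | succ i =>
      cases j with
      | zero =>
        rw [(Submodule.mem_bot ℚ).1 hy, zero_mul, mul_zero, sub_zero]
        exact zero_mem _
      | succ j =>
        obtain ⟨a, ha, ha', rfl⟩ := hx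
        obtain ⟨b, hb, hb', rfl⟩ := hy
        rw [adExt_commutator _ ha hb, show i + 1 + (j + 1) = (i + j + 1) + 1 by omega]
        exact ⟨_, by simpa using (L.tensor A).bracket_mem ha hb,
          tensorBracket_mem_tensorPow ha' hb', rfl⟩
  isNilpotent {i x} hx := by
    cases i with
    | zero => rw [(Submodule.mem_bot ℚ).1 hx]; exact IsNilpotent.zero
    | succ i =>
      obtain ⟨a, -, -, rfl⟩ := hx
      exact isNilpotent_adExt a
  exists_eq_bot := by
    obtain ⟨N, hN⟩ := exists_tensorPow_eq_bot (L := L) (A := A)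
    refine ⟨N + 1, fun i hi => ?_⟩
    obtain ⟨k, rfl⟩ := Nat.exists_eq_add_of_le' hi
    rw [eq_bot_iff]
    rintro _ ⟨a, -, ha, rfl⟩
    have hbot := hN _ (Nat.le_add_left N k)
    replace ha : a ∈ tensorPow L A (k + N) := ha
    rw [hbot] at ha
    rw [(Submodule.mem_bot K).1 ha]
    exact (Submodule.mem_bot ℚ).2 (map_zero (L.tensor A).adExtLin)

/-- A composition of gauge transformations is one with the sum as parameter, up to gauge
transformations with parameters in `L ⊗ A ^ 2`. -/
theorem exists_gauge_gauge {a b : L.tensor A} (ha : a ∈ tensorGr L A 0)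
    (hb : b ∈ tensorGr L A 0) :
    ∃ ws : List (L.tensor A), (∀ w ∈ ws, w ∈ tensorGr L A 0 ∧ w ∈ tensorPow L A 1) ∧
      ∀ x, (L.tensor A).gauge a ((L.tensor A).gauge b x) =
        ws.foldr (L.tensor A).gauge ((L.tensor A).gauge (a + b) x) := by
  have h1 : ∀ a ∈ tensorGr L A 0, (L.tensor A).adExt a ∈ adFiltration L A 1 := fun a ha =>
    ⟨a, ha, mem_tensorPow_zero a, rfl⟩
  have hlist : ∀ Ws : List (Module.End K (L.tensor A × K)),
      (∀ w ∈ Ws, ∃ j, 2 ≤ j ∧ w ∈ adFiltration L A j) →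
      ∃ ws : List (L.tensor A), (∀ w ∈ ws, w ∈ tensorGr L A 0 ∧ w ∈ tensorPow L A 1) ∧
        ∀ x, (Ws.map IsNilpotent.exp).prod (x, 1) = (ws.foldr (L.tensor A).gauge x, 1) := by
    intro Ws
    induction Ws with
    | nil => exact fun _ => ⟨[], by simp, fun x => rfl⟩
    | cons W Ws ih =>
      intro h
      obtain ⟨ws, hws, hx⟩ := ih fun w hw => h w (List.mem_cons_of_mem _ hw)
      obtain ⟨j, hj, hW⟩ := h W List.mem_cons_self
      -- A filtration level of at least two means that the parameter lies in `tensorPow L A 1`, that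
      -- is, in `L ⊗ A ^ 2`.
      obtain ⟨j, rfl⟩ := Nat.exists_eq_add_of_le' hj
      obtain ⟨w, hw, hw', rfl⟩ := hW
      refine ⟨w :: ws, ?_, fun x => ?_⟩
      · rintro w' hw''
        rcases List.mem_cons.1 hw'' with rfl | hw''
        · exact ⟨hw, tensorPow_antitone (Nat.le_add_left 1 j) hw'⟩
        · exact hws w' hw''
      · rw [List.map_cons, List.prod_cons, Module.End.mul_apply, hx,
          exp_adExt_apply (isNilpotent_adExt w)]
        rfl
  obtain ⟨Ws, hWs, h⟩ :=
    GradedExp.exp_mul_exp isFiltration_adFiltration (h1 a ha) (h1 b hb)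
  obtain ⟨ws, hws, hx⟩ := hlist Ws hWs
  refine ⟨ws, hws, fun x => ?_⟩
  have h2 := LinearMap.congr_fun h (x, 1)
  have hab : (L.tensor A).adExt a + (L.tensor A).adExt b = (L.tensor A).adExt (a + b) :=
    (map_add (L.tensor A).adExtLin a b).symm
  rw [Module.End.mul_apply, Module.End.mul_apply, hab, exp_adExt_apply (isNilpotent_adExt _),
    exp_adExt_apply (isNilpotent_adExt _), exp_adExt_apply (isNilpotent_adExt _), hx] at h2
  exact congrArg Prod.fst h2

/-- The gauge action on Maurer-Cartan elements of `L ⊗ A`. -/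
noncomputable def act (x : (L.tensor A).MC) {a : L.tensor A} (ha : a ∈ tensorGr L A 0) :
    (L.tensor A).MC :=
  gaugeMC x a ha (isNilpotent_adExt a)

/-- The class of a Maurer-Cartan element. -/
def cls (x : (L.tensor A).MC) : L.Def.obj A := Quot.mk _ x

theorem cls_act (x : (L.tensor A).MC) {a : L.tensor A} (ha : a ∈ tensorGr L A 0) :
    cls (act x ha) = cls x :=
  (Quot.sound ⟨a, ha, rfl⟩).symm

theorem map_cls {B : NilpDGA K} (f : A ⟶ B) (x : (L.tensor A).MC) :
    L.Def.map f (cls x) = cls ((L.tensorMap f).mapMC x) := rfl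

theorem map_gauge {B : NilpDGA K} (f : A ⟶ B) (a x : L.tensor A) :
    (L.tensorMap f).lin ((L.tensor A).gauge a x) =
      (L.tensor B).gauge ((L.tensorMap f).lin a) ((L.tensorMap f).lin x) := by
  obtain ⟨n, hn⟩ := isNilpotent_adExt a
  refine (L.tensorMap f).map_gauge a x ⟨n, fun m hm => ?_⟩
  rw [pow_eq_zero_of_le hm hn, LinearMap.zero_apply]

theorem gaugeRel_symm {x y : (L.tensor A).MC} (h : (L.tensor A).GaugeRel x y) :
    (L.tensor A).GaugeRel y x := by
  obtain ⟨a, ha, h⟩ := h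
  exact ⟨-a, neg_mem ha, by rw [h, gauge_neg_gauge (isNilpotent_adExt a)]⟩

/-- Equality in `Quot` yields only the generated equivalence relation; as inverses are again gauge
transformations, it is reached by forward chains. -/
theorem reflTransGen_of_cls_eq {x y : (L.tensor A).MC} (h : cls x = cls y) :
    Relation.ReflTransGen (L.tensor A).GaugeRel x y := by
  have : Std.Symm (L.tensor A).GaugeRel := ⟨fun _ _ => gaugeRel_symm⟩
  have h' := Quot.eqvGen_exact h
  clear h
  induction h' with
  | rel _ _ h => exact .single h
  | refl => exact .refl
  | symm x y _ ih => exact Relation.ReflTransGen.stdSymm.symm _ _ ih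
  | trans _ _ _ _ _ ih ih' => exact ih.trans ih'

/-- Gauge equivalent elements differ by a gauge transformation up to gauge transformations with
parameters in `L ⊗ A ^ 2`. -/
theorem exists_gauge_of_cls_eq {x y : (L.tensor A).MC} (h : cls x = cls y) :
    ∃ a ∈ tensorGr L A 0, ∃ ws : List (L.tensor A),
      (∀ w ∈ ws, w ∈ tensorGr L A 0 ∧ w ∈ tensorPow L A 1) ∧
      y.1 = ws.foldr (L.tensor A).gauge ((L.tensor A).gauge a x.1) := by
  have h0 := reflTransGen_of_cls_eq h
  clear h
  induction h0 using Relation.ReflTransGen.head_induction_on with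
  | refl => exact ⟨0, zero_mem _, [], by simp, (gauge_zero _).symm⟩
  | head h' _ ih =>
    obtain ⟨b, hb, h'⟩ := h'
    obtain ⟨a, ha, ws, hws, h''⟩ := ih
    -- The first link `e ^ b` of the chain is merged with the parameter `a` of the rest; the
    -- correction terms `vs` act before those in `ws`.
    obtain ⟨vs, hvs, hg⟩ := exists_gauge_gauge ha hb
    refine ⟨a + b, add_mem ha hb, ws ++ vs, ?_, ?_⟩
    · intro w hw
      rcases List.mem_append.1 hw with hw | hw
      exacts [hws w hw, hvs w hw]
    · rw [List.foldr_append, ← hg, ← h', h'']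

end DGLA

/-! ### Homogeneous projections and contracting homotopies. -/

namespace GradedSpace

variable {K : Type u} [Field K] {V : Type v} [AddCommGroup V] [Module K V]
  {W : Type w} [AddCommGroup W] [Module K W] {gr : ℤ → Submodule K V} {gr' : ℤ → Submodule K W}

theorem proj_self (h : DirectSum.IsInternal gr) {i : ℤ} {x : V} (hx : x ∈ gr i) :
    proj gr h i x = x := by
  rw [proj_apply h hx, if_pos rfl]

/-- Allows preimages and primitives found without regard to degree to be replaced by homogeneous
ones. -/
theorem proj_map (h : DirectSum.IsInternal gr) (h' : DirectSum.IsInternal gr') (f : V →ₗ[K] W)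
    {k : ℤ} (hf : ∀ i, ∀ x ∈ gr i, f x ∈ gr' (i + k)) (i : ℤ) (x : V) :
    proj gr' h' (i + k) (f x) = f (proj gr h i x) := by
  induction x using GradedSpace.induction h with
  | hom j x hx =>
    rw [proj_apply _ hx, proj_apply _ (hf j x hx)]
    by_cases hij : i = j
    · simp [hij]
    · simp [hij]
  | add x y hx hy => simp [hx, hy]

theorem proj_map_zero (h : DirectSum.IsInternal gr) (h' : DirectSum.IsInternal gr')
    (f : V →ₗ[K] W) (hf : ∀ i, ∀ x ∈ gr i, f x ∈ gr' i) (i : ℤ) (x : V) :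
    proj gr' h' i (f x) = f (proj gr h i x) := by
  have := proj_map h h' f (k := 0) (fun i x hx => by simpa using hf i x hx) i x
  rwa [add_zero] at this

end GradedSpace

/-- An acyclic endomorphism of square zero has a contracting homotopy. -/
theorem exists_contracting_homotopy {K V : Type*} [Field K] [AddCommGroup V] [Module K V]
    (D : V →ₗ[K] V) (hD : ∀ x, D (D x) = 0) (hex : ∀ x, D x = 0 → ∃ y, D y = x) :
    ∃ h : V →ₗ[K] V, ∀ x, D (h x) + h (D x) = x := by
  obtain ⟨s, hs⟩ := D.rangeRestrict.exists_rightInverse_of_surjective D.range_rangeRestrict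
  obtain ⟨S, hS⟩ := LinearMap.exists_extend s
  have hDS : ∀ x, D x = 0 → D (S x) = x := by
    intro x hx
    have h1 : S x = s ⟨x, hex x hx⟩ := LinearMap.congr_fun hS ⟨x, hex x hx⟩
    rw [h1]
    exact congrArg Subtype.val (LinearMap.congr_fun hs ⟨x, hex x hx⟩)
  -- Here `S` is linear with `D S = id` on cocycles. As `x - S D x` is a cocycle, `D h x = x - S D
  -- x`, while `h D x = S D x` because `D` has square zero.
  refine ⟨S ∘ₗ (LinearMap.id - S ∘ₗ D), fun x => ?_⟩
  simp only [LinearMap.comp_apply, LinearMap.sub_apply, LinearMap.id_apply, hD, map_zero,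
    sub_zero]
  rw [hDS _ (by rw [map_sub, hDS _ (hD x), sub_self])]
  abel

namespace DGLA

/-! ### Maurer-Cartan elements under surjections with central acyclic kernel -/

section CentralExtension

variable {K : Type u} [Field K] {M : DGLA.{u, v} K} {N : DGLA.{u, w} K}

/-- Bianchi's identity. -/
theorem d_curvature [CharZero K] {x : M} (hx : x ∈ M.gr 1) :
    M.d (M.d x + (2⁻¹ : K) • M.bracket x x) =
      - M.bracket x (M.d x + (2⁻¹ : K) • M.bracket x x) := by
  have hdx : M.d x ∈ M.gr 2 := M.d_mem hx
  have hxx : M.bracket x x ∈ M.gr 2 := M.bracket_mem hx hx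
  have h1 := M.leibniz hx hx
  have h2 := M.skew hdx hx
  have h3 := M.jacobi hx hx hx
  have h4 := M.skew hxx hx
  simp only [mul_one, even_two, Even.neg_zpow, one_zpow, one_smul, zpow_one, neg_smul] at h1 h2 h3 h4
  -- Jacobi gives `2 [x, [x, x]] = [[x, x], x]`, and antisymmetry makes the right side `-[x, [x,
  -- x]]`; characteristic zero then kills `[x, [x, x]]`.
  have h5 : (3 : K) • M.bracket x (M.bracket x x) = 0 := by
    have h6 := eq_neg_of_add_eq_zero_left h4
    rw [h6] at h3
    have h7 : M.bracket x (M.bracket x x) + M.bracket x (M.bracket x x) +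
      M.bracket x (M.bracket x x) = 0 := by
      nth_rewrite 1 [h3]
      abel
    rw [← h7]
    module
  have h8 : M.bracket x (M.bracket x x) = 0 := (smul_eq_zero.1 h5).resolve_left (by norm_num)
  rw [map_add, map_add, map_smul, map_smul, M.d_d, h8, h1, eq_neg_of_add_eq_zero_left h2]
  rw [smul_zero, add_zero, zero_add, ← sub_eq_add_neg, ← neg_add', ← two_smul K, smul_neg, smul_smul,
    inv_mul_cancel₀ two_ne_zero, one_smul]

/-- A surjection of graded Lie algebras with central acyclic kernel. -/
structure Hom.IsCentralAcyclic (f : Hom M N) : Prop where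
  surjective : ∀ {n : ℤ} {y : N}, y ∈ N.gr n → ∃ x ∈ M.gr n, f.lin x = y
  bracket_eq_zero : ∀ s t, f.lin t = 0 → M.bracket s t = 0
  acyclic : ∀ {n : ℤ} {t : M}, t ∈ M.gr n → f.lin t = 0 → M.d t = 0 →
    ∃ u ∈ M.gr (n - 1), f.lin u = 0 ∧ M.d u = t

variable {f : Hom M N}

theorem Hom.IsCentralAcyclic.bracket_eq_zero_left (hf : f.IsCentralAcyclic) {n : ℤ} {t : M}
    (ht : t ∈ M.gr n) (h0 : f.lin t = 0) (s : M) : M.bracket t s = 0 := by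
  induction s using GradedSpace.induction M.isInternal with
  | add s s' h h' => rw [map_add, h, h', add_zero]
  | hom i s hs => simpa [hf.bracket_eq_zero s t h0] using M.skew ht hs

/-- The curvature of any lift lies in the kernel, and it is closed by Bianchi's identity and
centrality. It is thus `d k` with `k` in the kernel, and subtracting `k` from the lift leaves the
brackets unchanged and removes the curvature. -/
theorem Hom.IsCentralAcyclic.exists_mapMC_eq [CharZero K] (hf : f.IsCentralAcyclic) (y : N.MC) :
    ∃ x : M.MC, f.mapMC x = y := by
  obtain ⟨x, hx, hxy⟩ := hf.surjective y.2.1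
  have hh : M.d x + (2⁻¹ : K) • M.bracket x x ∈ M.gr (1 + 1) :=
    add_mem (M.d_mem hx) (Submodule.smul_mem _ _ (M.bracket_mem hx hx))
  have hh0 : f.lin (M.d x + (2⁻¹ : K) • M.bracket x x) = 0 := by
    rw [map_add, map_smul, f.map_d, f.map_bracket, hxy]
    exact y.2.2
  obtain ⟨k, hk, hk0, hdk⟩ := hf.acyclic hh hh0
    (by rw [d_curvature hx, hf.bracket_eq_zero _ _ hh0, neg_zero])
  rw [add_sub_cancel_right] at hk
  refine ⟨⟨x - k, sub_mem hx hk, ?_⟩, Subtype.ext ?_⟩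
  · rw [map_sub (M.bracket (x - k)), hf.bracket_eq_zero _ _ hk0, map_sub M.bracket,
      LinearMap.sub_apply, hf.bracket_eq_zero_left hk hk0, map_sub, hdk]
    simp
  · change f.lin (x - k) = y.1
    rw [map_sub, hk0, hxy, sub_zero]

/-- The difference `y - x` is central, and subtracting the two Maurer–Cartan equations shows that it
is closed; so it is `d u` with `u` in the kernel. As `u` is central, `e ^ (-u)` acts as translation
by `d u`. -/
theorem Hom.IsCentralAcyclic.exists_gauge_eq (hf : f.IsCentralAcyclic) {x y : M.MC}
    (h : f.mapMC x = f.mapMC y) : ∃ a ∈ M.gr 0, y.1 = M.gauge a x.1 := by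
  obtain ⟨x, hx, hmx⟩ := x
  obtain ⟨y, hy, hmy⟩ := y
  obtain ⟨k, rfl⟩ : ∃ k, y = x + k := ⟨y - x, by abel⟩
  have hk : k ∈ M.gr 1 := by simpa using sub_mem hy hx
  have hk0 : f.lin k = 0 := by
    have h' : f.lin x = f.lin (x + k) := congrArg Subtype.val h
    simpa using h'
  rw [map_add (M.bracket (x + k)), hf.bracket_eq_zero _ _ hk0, map_add M.bracket,
    LinearMap.add_apply, hf.bracket_eq_zero_left hk hk0, add_zero, add_zero, map_add,
    add_right_comm, hmx, zero_add] at hmy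
  obtain ⟨u, hu, hu0, hdu⟩ := hf.acyclic hk hk0 hmy
  have hu' : -u ∈ M.gr 0 := neg_mem (by simpa using hu)
  have hz := hf.bracket_eq_zero_left hu' (by rw [map_neg, hu0, neg_zero])
  refine ⟨-u, hu', ?_⟩
  rw [gauge_eq (hz _), hz, map_neg, hdu]
  simp

end CentralExtension

/-! ### Exactness properties of `A ↦ L ⊗ A` -/

section Exactness

variable {K : Type u} [Field K] {L : DGLA.{u, v} K} {A B C : NilpDGA K}

open NilpDGA

theorem exists_lTensor_eq {f : A ⟶ B} (hf : Function.Surjective (NilpDGA.Hom.lin f)) {n : ℤ}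
    {t : L ⊗[K] B} (ht : t ∈ tensorGr L B n) :
    ∃ s ∈ tensorGr L A n, LinearMap.lTensor L (NilpDGA.Hom.lin f) s = t := by
  obtain ⟨s, rfl⟩ := LinearMap.lTensor_surjective L hf t
  refine ⟨GradedSpace.proj _ tensor_isInternal n s, GradedSpace.proj_mem _ _ _, ?_⟩
  rw [← GradedSpace.proj_map_zero tensor_isInternal tensor_isInternal _
    (fun i x hx => lTensor_mem f hx), GradedSpace.proj_self _ ht]

theorem prodRight_apply (z : L ⊗[K] (A × B)) : TensorProduct.prodRight K K L A B z =
    (LinearMap.lTensor L (LinearMap.fst K A B) z, LinearMap.lTensor L (LinearMap.snd K A B) z) := by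
  induction z using TensorProduct.induction_on with
  | zero => rw [map_zero, map_zero, map_zero]; rfl
  | add z z' h h' => rw [map_add, h, h', map_add, map_add]; rfl
  | tmul x p => obtain ⟨a, b⟩ := p; simp

/-- Flatness of `L` keeps the inclusion of the fibre product into `A × B` injective after tensoring.
-/
theorem fiber_ext {α : A ⟶ C} {β : B ⟶ C} {z z' : L ⊗[K] (fiberProd α β)}
    (h1 : LinearMap.lTensor L (NilpDGA.Hom.lin (fst α β)) z = LinearMap.lTensor L (NilpDGA.Hom.lin (fst α β)) z')
    (h2 : LinearMap.lTensor L (NilpDGA.Hom.lin (snd α β)) z =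
      LinearMap.lTensor L (NilpDGA.Hom.lin (snd α β)) z') : z = z' := by
  have hi : Function.Injective
      (LinearMap.lTensor L (LinearMap.prod (NilpDGA.Hom.lin (fst α β))
        (NilpDGA.Hom.lin (snd α β)))) :=
    Module.Flat.lTensor_preserves_injective_linearMap _ fun _ _ h => Subtype.ext h
  apply hi
  apply (TensorProduct.prodRight K K L A B).injective
  rw [prodRight_apply, prodRight_apply]
  simp only [← LinearMap.lTensor_comp_apply, LinearMap.fst_prod, LinearMap.snd_prod]
  exact Prod.ext h1 h2

/-- The fibre product is the kernel of `(a, b) ↦ α a - β b`, and flatness of `L` preserves this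
exactness. -/
theorem fiber_exists {α : A ⟶ C} {β : B ⟶ C} {s : L ⊗[K] A} {t : L ⊗[K] B}
    (h : LinearMap.lTensor L (NilpDGA.Hom.lin α) s = LinearMap.lTensor L (NilpDGA.Hom.lin β) t) :
    ∃ z : L ⊗[K] (fiberProd α β), LinearMap.lTensor L (NilpDGA.Hom.lin (fst α β)) z = s ∧
      LinearMap.lTensor L (NilpDGA.Hom.lin (snd α β)) z = t := by
  let g : A × B →ₗ[K] C :=
    NilpDGA.Hom.lin α ∘ₗ LinearMap.fst K A B - NilpDGA.Hom.lin β ∘ₗ LinearMap.snd K A B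
  have hex : Function.Exact (LinearMap.prod (NilpDGA.Hom.lin (fst α β))
      (NilpDGA.Hom.lin (snd α β))) g := by
    intro p
    change NilpDGA.Hom.lin α p.1 - NilpDGA.Hom.lin β p.2 = 0 ↔ _
    rw [sub_eq_zero]
    exact ⟨fun hp => ⟨⟨p, hp⟩, rfl⟩, by rintro ⟨q, rfl⟩; exact q.2⟩
  set w := (TensorProduct.prodRight K K L A B).symm (s, t) with hw
  have hw' : TensorProduct.prodRight K K L A B w = (s, t) := by rw [hw, LinearEquiv.apply_symm_apply]
  rw [prodRight_apply] at hw'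
  have hs := congrArg Prod.fst hw'
  have ht := congrArg Prod.snd hw'
  simp only at hs ht
  have hg : LinearMap.lTensor L g w = 0 := by
    rw [LinearMap.lTensor_sub, LinearMap.sub_apply, LinearMap.lTensor_comp_apply,
      LinearMap.lTensor_comp_apply, hs, ht, h, sub_self]
  obtain ⟨z, hz⟩ := (Module.Flat.lTensor_exact L hex w).1 hg
  refine ⟨z, ?_, ?_⟩
  · rw [← hs, ← hz, ← LinearMap.lTensor_comp_apply]; rfl
  · rw [← ht, ← hz, ← LinearMap.lTensor_comp_apply]; rfl

/-- Both components of `z` agree with those of its degree `n` projection, so `z` equals that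
projection. -/
theorem fiber_mem {α : A ⟶ C} {β : B ⟶ C} {n : ℤ} {z : L ⊗[K] (fiberProd α β)}
    (h1 : LinearMap.lTensor L (NilpDGA.Hom.lin (fst α β)) z ∈ tensorGr L A n)
    (h2 : LinearMap.lTensor L (NilpDGA.Hom.lin (snd α β)) z ∈ tensorGr L B n) :
    z ∈ tensorGr L (fiberProd α β) n := by
  have : z = GradedSpace.proj _ tensor_isInternal n z := by
    apply fiber_ext
    · rw [← GradedSpace.proj_map_zero tensor_isInternal tensor_isInternal _
        (fun i x hx => lTensor_mem (fst α β) hx), GradedSpace.proj_self _ h1]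
    · rw [← GradedSpace.proj_map_zero tensor_isInternal tensor_isInternal _
        (fun i x hx => lTensor_mem (snd α β) hx), GradedSpace.proj_self _ h2]
  rw [this]
  exact GradedSpace.proj_mem _ _ _

theorem fiber_exists_homogeneous {α : A ⟶ C} {β : B ⟶ C} {n : ℤ} {s : L ⊗[K] A} {t : L ⊗[K] B}
    (hs : s ∈ tensorGr L A n) (ht : t ∈ tensorGr L B n)
    (h : LinearMap.lTensor L (NilpDGA.Hom.lin α) s = LinearMap.lTensor L (NilpDGA.Hom.lin β) t) :
    ∃ z ∈ tensorGr L (fiberProd α β) n, LinearMap.lTensor L (NilpDGA.Hom.lin (fst α β)) z = s ∧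
      LinearMap.lTensor L (NilpDGA.Hom.lin (snd α β)) z = t := by
  obtain ⟨z, rfl, rfl⟩ := fiber_exists h
  exact ⟨z, fiber_mem hs ht, rfl, rfl⟩

/-- The kernel of `L ⊗ A → L ⊗ B` is the tensor product of `L` with the kernel of `A → B`. -/
theorem exists_lTensor_ker {f : A ⟶ B} {t : L ⊗[K] A}
    (ht : LinearMap.lTensor L (NilpDGA.Hom.lin f) t = 0) :
    ∃ s : L ⊗[K] LinearMap.ker (NilpDGA.Hom.lin f),
      LinearMap.lTensor L (LinearMap.ker (NilpDGA.Hom.lin f)).subtype s = t :=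
  (Module.Flat.lTensor_exact L (LinearMap.exact_subtype_ker_map (NilpDGA.Hom.lin f)) t).1 ht

theorem tensorBracket_eq_zero_of_mul {f : A ⟶ B} (hf : ∀ a x : A, NilpDGA.Hom.lin f x = 0 → a * x = 0)
    (s : L ⊗[K] A) {t : L ⊗[K] A} (ht : LinearMap.lTensor L (NilpDGA.Hom.lin f) t = 0) :
    tensorBracket L A s t = 0 := by
  obtain ⟨t, rfl⟩ := exists_lTensor_ker ht
  clear ht
  induction s using TensorProduct.induction_on with
  | zero => simp
  | add s s' h h' => rw [map_add, LinearMap.add_apply, h, h', add_zero]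
  | tmul x a =>
    induction t using TensorProduct.induction_on with
    | zero => simp
    | add t t' h h' => rw [map_add, map_add, h, h', add_zero]
    | tmul y b =>
      simp [tensorBracket, hf _ b.1 b.2]

/-- Acyclicity is given degree by degree; summing primitives of the homogeneous parts gives
exactness of the whole kernel, which over a field is contractible. The homotopy is not required to
be homogeneous. -/
theorem exists_ker_homotopy {f : A ⟶ B} (hf : IsAcyclicSmallExtension f) :
    ∃ h : A →ₗ[K] A, (∀ x, NilpDGA.Hom.lin f (h x) = 0) ∧
      ∀ x, NilpDGA.Hom.lin f x = 0 → A.d (h x) + h (A.d x) = x := by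
  let I := LinearMap.ker (NilpDGA.Hom.lin f)
  let D : I →ₗ[K] I := A.d.restrict fun x hx => by
    rw [LinearMap.mem_ker] at hx ⊢
    rw [lin_d, hx, map_zero]
  have hex : ∀ x : I, D x = 0 → ∃ y, D y = x := by
    rintro ⟨x, hx⟩ hd
    replace hd : A.d x = 0 := congrArg Subtype.val hd
    replace hx : NilpDGA.Hom.lin f x = 0 := hx
    have hi : ∀ i, ∃ y, NilpDGA.Hom.lin f y = 0 ∧ A.d y = GradedSpace.proj A.gr A.isInternal i x := by
      intro i
      have h1 := GradedSpace.proj_map A.isInternal A.isInternal A.d (fun i x hx => A.d_mem hx) i x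
      obtain ⟨y, -, hy, hy'⟩ := hf.acyclic i _ (GradedSpace.proj_mem A.isInternal i x)
        (by rw [← proj_lin, hx, map_zero]) (by rw [← h1, hd, map_zero])
      exact ⟨y, hy, hy'⟩
    choose y hy hy' using hi
    obtain ⟨s, hs⟩ := GradedSpace.exists_sum_proj A.isInternal x
    refine ⟨⟨∑ i ∈ s, y i, ?_⟩, Subtype.ext ?_⟩
    · rw [LinearMap.mem_ker, map_sum]
      exact Finset.sum_eq_zero fun i _ => hy i
    · change A.d (∑ i ∈ s, y i) = x
      rw [map_sum, Finset.sum_congr rfl fun i _ => hy' i, hs s subset_rfl]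
  obtain ⟨h, hh⟩ := exists_contracting_homotopy D (fun x => Subtype.ext (A.d_d _)) hex
  -- A linear projection onto the kernel extends the homotopy to all of `A`, so that it can be
  -- tensored with `L`.
  obtain ⟨π, hπ⟩ := I.subtype.exists_leftInverse_of_injective I.ker_subtype
  have hπ' : ∀ x (hx : NilpDGA.Hom.lin f x = 0), π x = ⟨x, hx⟩ := fun x hx =>
    LinearMap.congr_fun hπ ⟨x, hx⟩
  refine ⟨I.subtype ∘ₗ h ∘ₗ π, fun x => (h (π x)).2, fun x hx => ?_⟩
  have hdx : NilpDGA.Hom.lin f (A.d x) = 0 := by rw [lin_d, hx, map_zero]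
  simp only [LinearMap.comp_apply]
  rw [hπ' x hx, hπ' _ hdx]
  exact congrArg Subtype.val (hh ⟨x, hx⟩)

/-- A contraction `h` of the kernel of `f` induces the contraction `x ⊗ a ↦ (-1) ^ (deg x) x ⊗ h a`
of its tensor product with `L`: the sign cancels the terms `d x ⊗ h a`. A cocycle `t` is therefore
`d (H t)`, and projecting `H t` to degree `n - 1` makes the primitive homogeneous. -/
theorem exists_primitive [CharZero K] {f : A ⟶ B} (hf : IsAcyclicSmallExtension f) {n : ℤ} {t : L ⊗[K] A}
    (ht : t ∈ tensorGr L A n) (h0 : LinearMap.lTensor L (NilpDGA.Hom.lin f) t = 0)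
    (hd : tensorD L A t = 0) :
    ∃ u ∈ tensorGr L A (n - 1), LinearMap.lTensor L (NilpDGA.Hom.lin f) u = 0 ∧ tensorD L A u = t := by
  obtain ⟨h, hf0, hh⟩ := exists_ker_homotopy hf
  let H : L ⊗[K] A →ₗ[K] L ⊗[K] A :=
    TensorProduct.map (GradedSpace.parity L.gr L.isInternal) h
  have hH0 : ∀ t, LinearMap.lTensor L (NilpDGA.Hom.lin f) (H t) = 0 := by
    intro t
    induction t using TensorProduct.induction_on with
    | zero => simp
    | add s s' h h' => rw [map_add, map_add, h, h', add_zero]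
    | tmul x a => simp [H, hf0]
  have hH : tensorD L A (H t) + H (tensorD L A t) = t := by
    obtain ⟨s, rfl⟩ := exists_lTensor_ker h0
    clear h0 ht hd
    induction s using TensorProduct.induction_on with
    | zero => simp
    | add s s' h h' =>
      simp only [map_add]
      nth_rewrite 3 [← h]
      nth_rewrite 3 [← h']
      abel
    | tmul x a =>
      obtain ⟨a, ha⟩ := a
      replace ha : NilpDGA.Hom.lin f a = 0 := ha
      induction x using GradedSpace.induction L.isInternal with
      | add x y hx hy =>
        simp only [TensorProduct.add_tmul, map_add]
        nth_rewrite 3 [← hx]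
        nth_rewrite 3 [← hy]
        abel
      | hom i x hx =>
        have h4 : ((-1 : K) ^ i) * (-1) ^ i = 1 := by
          rw [← mul_zpow]; simp
        have h5 : ((-1 : K) ^ (i + 1)) = - (-1) ^ i := by
          rw [zpow_add₀ (by simp)]; simp
        rw [LinearMap.lTensor_tmul, tensorD_tmul hx]
        simp only [H, TensorProduct.map_tmul, map_add, map_smul, Submodule.subtype_apply]
        rw [GradedSpace.parity_apply _ hx, GradedSpace.parity_apply _ (L.d_mem hx),
          ← TensorProduct.smul_tmul', ← TensorProduct.smul_tmul', ← TensorProduct.smul_tmul',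
          map_smul, tensorD_tmul hx, h5, smul_add, smul_smul, smul_smul, h4, one_smul, one_smul]
        nth_rewrite 5 [← hh a ha]
        rw [TensorProduct.tmul_add]
        module
  rw [hd, map_zero, add_zero] at hH
  refine ⟨GradedSpace.proj _ tensor_isInternal (n - 1) (H t), GradedSpace.proj_mem _ _ _, ?_, ?_⟩
  · rw [← GradedSpace.proj_map_zero tensor_isInternal tensor_isInternal _
      (fun i x hx => lTensor_mem f hx), hH0, map_zero]
  · have h1 := GradedSpace.proj_map tensor_isInternal tensor_isInternal (tensorD L A)
      (fun i x hx => (L.tensor A).d_mem hx) (n - 1) (H t)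
    rw [← h1, hH, sub_add_cancel, GradedSpace.proj_self _ ht]

end Exactness

end DGLA

namespace DGLA

/-! ### `Def_L` is a deformation functor -/

section DeformationFunctor

variable {K : Type u} [Field K] {L : DGLA.{u, v} K} {A B C : NilpDGA K}

open NilpDGA

/-- Makes `exists_primitive` available as the acyclicity of `L ⊗ C`. -/
theorem isAcyclicSmallExtension_zeroHom (hC : C.IsTrivial) (hC' : C.IsAcyclic) :
    IsAcyclicSmallExtension (zeroHom C (zeroObj K)) where
  surjective _ := ⟨0, Subsingleton.elim _ _⟩
  mul_eq_zero _ _ _ := hC _ _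
  acyclic i x hx _ hd := by
    obtain ⟨y, hy, h⟩ := hC' i ⟨hx, hd⟩
    exact ⟨y, hy, rfl, h⟩

theorem tensorBracket_eq_zero (hC : C.IsTrivial) (s t : L ⊗[K] C) : tensorBracket L C s t = 0 :=
  tensorBracket_eq_zero_of_mul (f := zeroHom C (zeroObj K)) (fun _ _ _ => hC _ _) s (by simp)

/-- Products map to products, which vanish in `C`, so `A ^ 2` maps to zero. This is why corrections
in `L ⊗ A ^ 2` do no harm over `C`. -/
theorem map_tensorPow_one {f : A ⟶ C} (hC : C.IsTrivial) {t : L ⊗[K] A}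
    (ht : t ∈ tensorPow L A 1) : LinearMap.lTensor L (NilpDGA.Hom.lin f) t = 0 := by
  induction ht using Submodule.span_induction with
  | zero => simp
  | add s t _ _ h h' => rw [map_add, h, h', add_zero]
  | smul c t _ h => rw [map_smul, h, smul_zero]
  | mem t ht =>
    obtain ⟨x, a, ha, rfl⟩ := ht
    have : NilpDGA.Hom.lin f a = 0 := by
      induction ha using Submodule.span_induction with
      | zero => simp
      | add s t _ _ h h' => rw [map_add, h, h', add_zero]
      | smul c t _ h => rw [map_smul, h, smul_zero]
      | mem a ha =>
        obtain ⟨b, c, -, rfl⟩ := ha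
        rw [lin_mul, hC]
    rw [LinearMap.lTensor_tmul, this, TensorProduct.tmul_zero]

variable [CharZero K]

theorem exists_cls (z : L.Def.obj A) : ∃ x, cls x = z := Quot.exists_rep z

/-- Gauge equivalences lift along surjections. -/
theorem exists_lift_of_cls_eq {f : A ⟶ B} (hf : Function.Surjective (NilpDGA.Hom.lin f))
    (x : (L.tensor A).MC) {y : (L.tensor B).MC} (h : cls ((L.tensorMap f).mapMC x) = cls y) :
    ∃ x', cls x' = cls x ∧ (L.tensorMap f).mapMC x' = y := by
  have h0 := reflTransGen_of_cls_eq h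
  clear h
  induction h0 with
  | refl => exact ⟨x, rfl, rfl⟩
  | tail _ h ih =>
    obtain ⟨x', hx', rfl⟩ := ih
    obtain ⟨b, hb, h⟩ := h
    obtain ⟨a, ha, rfl⟩ := exists_lTensor_eq hf hb
    exact ⟨act x' ha, (cls_act x' ha).trans hx', Subtype.ext ((map_gauge f a x'.1).trans h.symm)⟩

/-- Maurer-Cartan elements of a fibre product. -/
theorem exists_fiber_mc {α : A ⟶ C} {β : B ⟶ C} (x : (L.tensor A).MC) (y : (L.tensor B).MC)
    (h : (L.tensorMap α).mapMC x = (L.tensorMap β).mapMC y) :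
    ∃ m : (L.tensor (fiberProd α β)).MC, (L.tensorMap (fst α β)).mapMC m = x ∧
      (L.tensorMap (snd α β)).mapMC m = y := by
  obtain ⟨z, hz, h1, h2⟩ := fiber_exists_homogeneous x.2.1 y.2.1 (congrArg Subtype.val h)
  refine ⟨⟨z, hz, ?_⟩, Subtype.ext h1, Subtype.ext h2⟩
  -- The Maurer–Cartan equation in the fibre product is checked on the two components.
  apply fiber_ext
  · refine Eq.trans ?_ (x.2.2.trans (map_zero _).symm)
    change (L.tensorMap (fst α β)).lin _ = _
    rw [map_add, map_smul, (L.tensorMap (fst α β)).map_d, (L.tensorMap (fst α β)).map_bracket,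
      show (L.tensorMap (fst α β)).lin z = x.1 from h1]
  · refine Eq.trans ?_ (y.2.2.trans (map_zero _).symm)
    change (L.tensorMap (snd α β)).lin _ = _
    rw [map_add, map_smul, (L.tensorMap (snd α β)).map_d, (L.tensorMap (snd α β)).map_bracket,
      show (L.tensorMap (snd α β)).lin z = y.1 from h2]

/-- The gauge equivalence over `C` lifts along `α`, so the representative over `A` can be moved
within its class until the two images in `C` are equal; then the representatives glue. -/
theorem comparison_surjective (α : A ⟶ C) (β : B ⟶ C)
    (hα : Function.Surjective (NilpDGA.Hom.lin α)) :
    Function.Surjective (comparison L.Def α β) := by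
  rintro ⟨⟨a, b⟩, h⟩
  obtain ⟨x, rfl⟩ := exists_cls a
  obtain ⟨y, rfl⟩ := exists_cls b
  obtain ⟨x', hx', h'⟩ := exists_lift_of_cls_eq hα x h
  obtain ⟨m, rfl, rfl⟩ := exists_fiber_mc x' y h'
  exact ⟨cls m, Subtype.ext (Prod.ext hx' rfl)⟩

theorem isCentralAcyclic_tensorMap {f : A ⟶ B} (hf : IsAcyclicSmallExtension f) :
    (L.tensorMap f).IsCentralAcyclic where
  surjective hy := exists_lTensor_eq hf.surjective hy
  bracket_eq_zero s _ ht := tensorBracket_eq_zero_of_mul hf.mul_eq_zero s ht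
  acyclic ht h0 hd := exists_primitive hf ht h0 hd

theorem map_bijective {f : A ⟶ B} (hf : IsAcyclicSmallExtension f) :
    Function.Bijective (L.Def.map f) := by
  have hf' := isCentralAcyclic_tensorMap (L := L) hf
  constructor
  · intro a b h
    obtain ⟨x, rfl⟩ := exists_cls a
    obtain ⟨y, rfl⟩ := exists_cls b
    obtain ⟨x', hx', h'⟩ := exists_lift_of_cls_eq hf.surjective x h
    rw [← hx']
    exact Quot.sound (hf'.exists_gauge_eq h')
  · intro b
    obtain ⟨y, rfl⟩ := exists_cls b
    obtain ⟨x, rfl⟩ := hf'.exists_mapMC_eq y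
    exact ⟨cls x, rfl⟩

theorem gauge_of_isTrivial (hC : C.IsTrivial) (a x : L ⊗[K] C) :
    (L.tensor C).gauge a x = x - tensorD L C a := by
  have h := gauge_eq (M := L.tensor C) (a := a) (x := x) (tensorBracket_eq_zero hC _ _)
  rw [h]
  change x + (tensorBracket L C a x - tensorD L C a) = _
  rw [tensorBracket_eq_zero hC]
  abel

theorem map_foldr_gauge (f : A ⟶ C) (hC : C.IsTrivial) (ws : List (L.tensor A))
    (hws : ∀ w ∈ ws, w ∈ tensorGr L A 0 ∧ w ∈ tensorPow L A 1) (x : L.tensor A) :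
    (L.tensorMap f).lin (ws.foldr (L.tensor A).gauge x) = (L.tensorMap f).lin x := by
  induction ws with
  | nil => rfl
  | cons w ws ih =>
    have h0 : (L.tensorMap f).lin w = 0 := map_tensorPow_one hC (hws w List.mem_cons_self).2
    rw [List.foldr_cons, map_gauge, h0, gauge_zero,
      ih fun w hw => hws w (List.mem_cons_of_mem _ hw)]

/-- Gauge transformations of a fibre product, given by pairs. -/
theorem exists_fiber_act {α : A ⟶ C} {β : B ⟶ C} (m : (L.tensor (fiberProd α β)).MC)
    {a : L ⊗[K] A} (ha : a ∈ tensorGr L A 0) {b : L ⊗[K] B} (hb : b ∈ tensorGr L B 0)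
    (h : (L.tensorMap α).lin a = (L.tensorMap β).lin b) :
    ∃ m' : (L.tensor (fiberProd α β)).MC, cls m' = cls m ∧
      (L.tensorMap (fst α β)).lin m'.1 =
        (L.tensor A).gauge a ((L.tensorMap (fst α β)).lin m.1) ∧
      (L.tensorMap (snd α β)).lin m'.1 =
        (L.tensor B).gauge b ((L.tensorMap (snd α β)).lin m.1) := by
  obtain ⟨p, hp, rfl, rfl⟩ := fiber_exists_homogeneous ha hb h
  exact ⟨act m hp, cls_act m hp, map_gauge _ _ _, map_gauge _ _ _⟩

/-- A parameter from `L ⊗ A ^ 2` or `L ⊗ B ^ 2` vanishes over `C`, so it can be paired with zero in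
the other factor and acts on the fibre product, moving one component only. -/
theorem exists_fiber_foldr {α : A ⟶ C} {β : B ⟶ C} (hC : C.IsTrivial)
    (m : (L.tensor (fiberProd α β)).MC) (ws : List (L.tensor A))
    (hws : ∀ w ∈ ws, w ∈ tensorGr L A 0 ∧ w ∈ tensorPow L A 1) (vs : List (L.tensor B))
    (hvs : ∀ w ∈ vs, w ∈ tensorGr L B 0 ∧ w ∈ tensorPow L B 1) :
    ∃ m' : (L.tensor (fiberProd α β)).MC, cls m' = cls m ∧
      (L.tensorMap (fst α β)).lin m'.1 =
        ws.foldr (L.tensor A).gauge ((L.tensorMap (fst α β)).lin m.1) ∧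
      (L.tensorMap (snd α β)).lin m'.1 =
        vs.foldr (L.tensor B).gauge ((L.tensorMap (snd α β)).lin m.1) := by
  induction ws with
  | nil =>
    induction vs with
    | nil => exact ⟨m, rfl, rfl, rfl⟩
    | cons w vs ih =>
      obtain ⟨m', hm', h1, h2⟩ := ih fun w hw => hvs w (List.mem_cons_of_mem _ hw)
      have hw := hvs w List.mem_cons_self
      have h0 : (L.tensorMap β).lin w = 0 := map_tensorPow_one hC hw.2
      obtain ⟨m'', hm'', h1', h2'⟩ := exists_fiber_act m' (zero_mem (tensorGr L A 0)) hw.1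
        (by rw [h0, map_zero])
      exact ⟨m'', hm''.trans hm', by rw [h1', gauge_zero, h1], by rw [h2', h2]; rfl⟩
  | cons w ws ih =>
    obtain ⟨m', hm', h1, h2⟩ := ih fun w hw => hws w (List.mem_cons_of_mem _ hw)
    have hw := hws w List.mem_cons_self
    have h0 : (L.tensorMap α).lin w = 0 := map_tensorPow_one hC hw.2
    obtain ⟨m'', hm'', h1', h2'⟩ := exists_fiber_act m' hw.1 (zero_mem (tensorGr L B 0))
      (by rw [h0, map_zero])
    exact ⟨m'', hm''.trans hm', by rw [h1', h1]; rfl, by rw [h2', gauge_zero, h2]⟩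

theorem comparison_injective (α : A ⟶ C) (β : B ⟶ C)
    (hα : Function.Surjective (NilpDGA.Hom.lin α)) (hC : C.IsTrivial) (hC' : C.IsAcyclic) :
    Function.Injective (comparison L.Def α β) := by
  intro z z' hzz'
  obtain ⟨m, rfl⟩ := exists_cls z
  obtain ⟨m', rfl⟩ := exists_cls z'
  have h1 : cls ((L.tensorMap (fst α β)).mapMC m) = cls ((L.tensorMap (fst α β)).mapMC m') :=
    congrArg (fun p => p.1.1) hzz'
  have h2 : cls ((L.tensorMap (snd α β)).mapMC m) = cls ((L.tensorMap (snd α β)).mapMC m') :=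
    congrArg (fun p => p.1.2) hzz'
  obtain ⟨a, ha, ws, hws, hx⟩ := exists_gauge_of_cls_eq h1
  obtain ⟨b, hb, vs, hvs, hy⟩ := exists_gauge_of_cls_eq h2
  set x := (L.tensorMap (fst α β)).mapMC m with hxdef
  set y := (L.tensorMap (snd α β)).mapMC m with hydef
  have hc : ∀ m : (L.tensor (fiberProd α β)).MC,
      (L.tensorMap α).lin ((L.tensorMap (fst α β)).mapMC m).1 =
        (L.tensorMap β).lin ((L.tensorMap (snd α β)).mapMC m).1 := fun m => by
    change LinearMap.lTensor L _ (LinearMap.lTensor L _ m.1) =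
      LinearMap.lTensor L _ (LinearMap.lTensor L _ m.1)
    rw [← LinearMap.lTensor_comp_apply, ← LinearMap.lTensor_comp_apply, ← lin_comp, ← lin_comp,
      fiber_condition]
  -- Both components of `m'` have the same image in `L ⊗ C`, and so do those of `m`. As gauge acts
  -- there by `x ↦ x - d a` and the corrections `ws`, `vs` are invisible, the images of `a` and `b`
  -- have equal differentials.
  have hd : tensorD L C ((L.tensorMap β).lin b - (L.tensorMap α).lin a) = 0 := by
    have h := hc m'
    rw [hx, hy, map_foldr_gauge α hC ws hws, map_foldr_gauge β hC vs hvs, map_gauge, map_gauge,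
      gauge_of_isTrivial hC, gauge_of_isTrivial hC, hc m, sub_right_inj] at h
    rw [map_sub, h, sub_self]
  have hab : (L.tensorMap β).lin b - (L.tensorMap α).lin a ∈ tensorGr L C 0 :=
    sub_mem ((L.tensorMap β).map_gr hb) ((L.tensorMap α).map_gr ha)
  obtain ⟨h, hh, -, hdh⟩ := exists_primitive (isAcyclicSmallExtension_zeroHom hC hC') hab
    (by simp) hd
  obtain ⟨k, hk, rfl⟩ := exists_lTensor_eq hα hh
  have hk' : k ∈ (L.tensor A).gr (-1) := by simpa using hk
  -- Here `k` lifts a primitive of the discrepancy. The element `s` stabilizes `x`, and its image in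
  -- `L ⊗ C` is the whole discrepancy because brackets vanish there.
  set s := (L.tensor A).d k + (L.tensor A).bracket x.1 k with hs
  have hs0 : s ∈ tensorGr L A 0 :=
    add_mem (by simpa using (L.tensor A).d_mem hk')
      (by simpa using (L.tensor A).bracket_mem x.2.1 hk')
  have hsx : (L.tensor A).gauge s x.1 = x.1 := by
    have h0 := congrArg Prod.fst (adExt_stabilizer x hk')
    rw [adExt_apply, one_smul] at h0
    replace h0 : (L.tensor A).bracket s x.1 - (L.tensor A).d s = 0 := h0
    rw [gauge_eq (by rw [h0, map_zero]), h0, add_zero]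
  have hsα : (L.tensorMap α).lin s = (L.tensorMap β).lin b - (L.tensorMap α).lin a := by
    rw [hs, map_add, (L.tensorMap α).map_d, (L.tensorMap α).map_bracket]
    refine Eq.trans (congrArg₂ (· + ·) hdh (tensorBracket_eq_zero hC _ _)) (add_zero _)
  -- Since `e ^ s` fixes `x`, `e ^ a x = e ^ a e ^ s x`, which is `e ^ (a + s) x` followed by
  -- corrections `us`. The parameters `a + s` and `b` now agree over `C` and form a parameter on the
  -- fibre product.
  obtain ⟨us, hus, hg⟩ := exists_gauge_gauge ha hs0
  have hx' := hg x.1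
  rw [hsx] at hx'
  obtain ⟨m₁, hm₁, e₁, e₁'⟩ := exists_fiber_act (α := α) (β := β) m (add_mem ha hs0) hb
    (by rw [map_add, hsα]; abel)
  obtain ⟨m₂, hm₂, e₂, e₂'⟩ := exists_fiber_foldr hC m₁ (ws ++ us) (by
    intro w hw
    rcases List.mem_append.1 hw with hw | hw
    exacts [hws w hw, hus w hw]) vs hvs
  rw [← hm₁, ← hm₂]
  refine congrArg cls (Subtype.ext (fiber_ext ?_ ?_))
  · refine e₂.trans (Eq.trans ?_ hx.symm)
    rw [List.foldr_append, e₁, hx']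
    rfl
  · refine e₂'.trans (Eq.trans ?_ hy.symm)
    rw [e₁']
    rfl

theorem isDeformationFunctor_def (L : DGLA.{u, v} K) : IsDeformationFunctor L.Def where
  zero := by
    refine ⟨cls ⟨0, zero_mem _, by simp⟩, fun y => ?_⟩
    obtain ⟨x, rfl⟩ := exists_cls y
    have : Subsingleton (L ⊗[K] (zeroObj K : Type u)) := inferInstance
    exact congrArg cls (Subtype.ext (Subsingleton.elim _ _))
  surjective α β hα := comparison_surjective α β hα
  bijective α β hα hC hC' :=
    ⟨comparison_injective α β hα hC hC', comparison_surjective α β hα⟩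
  quasismooth f hf := (map_bijective hf).2
  acyclic_bijective f hf := map_bijective hf

end DeformationFunctor

end DGLA

namespace DGLA

/-! ### The tangent spaces of `Def_L` -/

section Tangent

variable {K : Type u} [Field K] (L : DGLA.{u, v} K)

open NilpDGA

/-- The generator of `K[n]`. -/
def lineOne (K : Type u) [Field K] (n : ℤ) : line K n := Line.one K

theorem lineOne_mem (n : ℤ) : lineOne K n ∈ (line K n).gr (-n) := by
  change Line.one K ∈ (if -n + n = 0 then (⊤ : Submodule K (Line K)) else ⊥)
  rw [if_pos (by omega)]
  trivial

theorem line_gr_eq_bot {n j : ℤ} (h : j + n ≠ 0) : (line K n).gr j = ⊥ := if_neg h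

theorem exists_smul_lineOne {n : ℤ} (a : line K n) : ∃ c : K, a = c • lineOne K n :=
  ⟨(show K from a), (mul_one (show K from a)).symm⟩

theorem line_d (n : ℤ) (a : line K n) : (line K n).d a = 0 := rfl

/-- The linear map `L ⊗ K[n] → L` inverse to `x ↦ x ⊗ 1`. -/
noncomputable def evalLine (n : ℤ) : L ⊗[K] (line K n) →ₗ[K] L :=
  TensorProduct.lift (LinearMap.mk₂ K (fun (x : L) (a : line K n) => (show K from a) • x)
    (fun x y _ => smul_add _ x y) (fun c x _ => smul_comm _ c x)
    (fun x a b => add_smul (show K from a) (show K from b) x)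
    (fun c x a => mul_smul c (show K from a) x))

theorem evalLine_tmul_one (n : ℤ) (x : L) : evalLine L n (x ⊗ₜ lineOne K n) = x :=
  one_smul K x

/-- `K[n]` lives in degree `-n`, which accounts for the shift by `n`. For `n = i - 1`, degree one
gives `L ^ i` (cocycles) and degree zero gives `L ^ (i - 1)` (gauge parameters). -/
theorem exists_eq_tmul_one {n m : ℤ} {t : L ⊗[K] (line K n)} (ht : t ∈ tensorGr L (line K n) m) :
    ∃ x ∈ L.gr (m + n), t = x ⊗ₜ lineOne K n := by
  induction ht using tensorGr_induction with
  | zero => exact ⟨0, zero_mem _, (TensorProduct.zero_tmul _ _).symm⟩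
  | add s t _ _ hs ht =>
    obtain ⟨x, hx, rfl⟩ := hs
    obtain ⟨y, hy, rfl⟩ := ht
    exact ⟨x + y, add_mem hx hy, (TensorProduct.add_tmul _ _ _).symm⟩
  | smul c s _ hs =>
    obtain ⟨x, hx, rfl⟩ := hs
    exact ⟨c • x, Submodule.smul_mem _ c hx, TensorProduct.smul_tmul' c x _⟩
  | tmul i j h x hx a ha =>
    by_cases hj : j + n = 0
    · obtain ⟨c, rfl⟩ := exists_smul_lineOne a
      refine ⟨c • x, ?_, (TensorProduct.smul_tmul c x _).symm⟩
      rw [show m + n = i by omega]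
      exact Submodule.smul_mem _ _ hx
    · rw [line_gr_eq_bot hj, Submodule.mem_bot] at ha
      exact ⟨0, zero_mem _, by rw [ha, TensorProduct.zero_tmul, TensorProduct.tmul_zero]⟩

theorem tensorD_tmul_one {i : ℤ} {x : L} (hx : x ∈ L.gr i) (n : ℤ) :
    tensorD L (line K n) (x ⊗ₜ lineOne K n) =
      L.d x ⊗ₜ lineOne K n := by
  rw [tensorD_tmul hx, line_d, TensorProduct.tmul_zero, smul_zero, add_zero]

variable [CharZero K] (i : ℤ)

/-- The Maurer-Cartan element `z ⊗ 1` of a cocycle `z`. -/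
noncomputable def lineMC (z : GradedSpace.cocycles L.gr L.d i) :
    (L.tensor (line K (i - 1))).MC :=
  ⟨(z : L) ⊗ₜ[K] lineOne K (i - 1),
    tmul_mem (by omega) z.2.1 (lineOne_mem (i - 1)), by
      change tensorD L _ _ + (2⁻¹ : K) • tensorBracket L _ _ _ = 0
      rw [tensorBracket_eq_zero (line_isTrivial _), tensorD_tmul_one L z.2.1,
        LinearMap.mem_ker.1 z.2.2, TensorProduct.zero_tmul, smul_zero, add_zero]⟩

/-- The pair `(x, y)` is a Maurer–Cartan element over `A × A`, and the addition morphism, which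
defines the sum of classes, sends it to `x + y`. -/
theorem toVec_cls_add {L : DGLA.{u, v} K} (hF : IsPredeformationFunctor L.Def) {A : NilpDGA K}
    (hA : A.IsTrivial) {x y z : (L.tensor A).MC} (h : z.1 = x.1 + y.1) :
    hF.toVec hA (cls z) = hF.toVec hA (cls x) + hF.toVec hA (cls y) := by
  have : Subsingleton (L ⊗[K] (zeroObj K : Type u)) := inferInstance
  obtain ⟨m, rfl, rfl⟩ := exists_fiber_mc (α := zeroHom A (zeroObj K))
    (β := zeroHom A (zeroObj K)) x y (Subtype.ext (Subsingleton.elim _ _))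
  refine Eq.trans ?_ (hF.map_addHom hA (hA.prod hA) (pr₁ _ _) (pr₂ _ _) (cls m))
  rw [map_cls]
  refine congrArg (fun z => hF.toVec hA (cls z)) (Subtype.ext (h.trans ?_))
  exact (LinearMap.congr_fun (LinearMap.lTensor_add L (NilpDGA.Hom.lin (pr₁ A A))
    (NilpDGA.Hom.lin (pr₂ A A))) m.1).symm

theorem toVec_cls_smul {L : DGLA.{u, v} K} (hF : IsPredeformationFunctor L.Def) {A : NilpDGA K}
    (hA : A.IsTrivial) {x z : (L.tensor A).MC} {c : K} (h : z.1 = c • x.1) :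
    hF.toVec hA (cls z) = c • hF.toVec hA (cls x) := by
  change hF.toVec hA (cls z) = L.Def.map (smulHom hA hA c (𝟙 A)) (cls x)
  rw [map_cls]
  refine congrArg (fun z => hF.toVec hA (cls z)) (Subtype.ext (h.trans ?_))
  refine Eq.trans ?_ (LinearMap.congr_fun (LinearMap.lTensor_smul L c
    (NilpDGA.Hom.lin (𝟙 A))) x.1).symm
  rw [lin_id, LinearMap.lTensor_id]
  rfl

/-- The linear map from cocycles to the tangent space. -/
noncomputable def toTangent :
    GradedSpace.cocycles L.gr L.d i →ₗ[K] (isDeformationFunctor_def L).tangentSpace i where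
  toFun z := (isDeformationFunctor_def L).toVec (line_isTrivial (i - 1)) (cls (lineMC L i z))
  map_add' _ _ := toVec_cls_add _ _ (TensorProduct.add_tmul _ _ _)
  map_smul' c _ := toVec_cls_smul _ _ (TensorProduct.smul_tmul' c _ _).symm

/-- Over `K[i - 1]` the gauge action of `w ⊗ 1` subtracts `d w ⊗ 1`, so `z ⊗ 1` reaches zero exactly
when `z` is some `d w`. -/
theorem cls_lineMC_eq_iff (z : GradedSpace.cocycles L.gr L.d i) :
    cls (lineMC L i z) = cls (lineMC L i 0) ↔
      z ∈ (GradedSpace.coboundaries L.gr L.d i).submoduleOf (GradedSpace.cocycles L.gr L.d i) := by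
  have hA := line_isTrivial (K := K) (i - 1)
  have hval : (lineMC L i 0).1 = 0 := TensorProduct.zero_tmul _ _
  constructor
  · intro h
    obtain ⟨a, ha, ws, hws, h⟩ := exists_gauge_of_cls_eq h
    -- Applied to the identity: `K[i - 1]` has zero multiplication itself, so the corrections `ws`
    -- act trivially.
    have h1 := map_foldr_gauge (𝟙 (line K (i - 1))) hA ws hws
      ((L.tensor (line K (i - 1))).gauge a (lineMC L i z).1)
    have hid : ∀ t, (L.tensorMap (𝟙 (line K (i - 1)))).lin t = t :=
      LinearMap.congr_fun (LinearMap.lTensor_id _ _)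
    rw [hid, hid, ← h, hval, gauge_of_isTrivial hA] at h1
    obtain ⟨w, hw, rfl⟩ := exists_eq_tmul_one L ha
    rw [tensorD_tmul_one L hw, eq_comm, sub_eq_zero] at h1
    have h2 := congrArg (evalLine L (i - 1)) h1
    rw [evalLine_tmul_one] at h2
    refine ⟨w, by simpa using hw, ?_⟩
    rw [← h2]
    exact evalLine_tmul_one L _ _
  · rintro ⟨w, hw, h⟩
    have h' : L.d w = z := h
    refine Quot.sound ⟨w ⊗ₜ lineOne K (i - 1),
      tmul_mem (by omega) hw (lineOne_mem (i - 1)), ?_⟩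
    rw [gauge_of_isTrivial hA, tensorD_tmul_one L hw, hval, h']
    exact (sub_self _).symm

theorem ker_toTangent : LinearMap.ker (toTangent L i) =
    (GradedSpace.coboundaries L.gr L.d i).submoduleOf (GradedSpace.cocycles L.gr L.d i) := by
  ext z
  rw [LinearMap.mem_ker, ← map_zero (toTangent L i)]
  exact cls_lineMC_eq_iff L i z

/-- Every element of degree one is `z ⊗ 1`, and with vanishing bracket the Maurer–Cartan equation
reads `d z ⊗ 1 = 0`; evaluation at the generator gives `d z = 0`. -/
theorem toTangent_surjective : Function.Surjective (toTangent L i) := by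
  intro t
  obtain ⟨x, hx⟩ := exists_cls (L := L) (A := line K (i - 1)) t
  obtain ⟨z, hz, hxz⟩ := exists_eq_tmul_one L x.2.1
  have hz' : z ∈ L.gr i := by simpa using hz
  have h := x.2.2
  have h1 : tensorD L (line K (i - 1)) x.1 + (2⁻¹ : K) • tensorBracket L _ x.1 x.1 = 0 := h
  rw [tensorBracket_eq_zero (line_isTrivial _), smul_zero, add_zero, hxz,
    tensorD_tmul_one L hz] at h1
  have h2 := congrArg (evalLine L (i - 1)) h1
  rw [evalLine_tmul_one, map_zero] at h2
  refine ⟨⟨z, hz', h2⟩, Eq.trans (congrArg cls (Subtype.ext ?_)) hx⟩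
  exact hxz.symm

/-- The isomorphism of `H^i(L)` with the tangent space. -/
noncomputable def tangentEquiv : L.H i ≃ₗ[K] (isDeformationFunctor_def L).tangentSpace i :=
  (Submodule.quotEquivOfEq _ _ (ker_toTangent L i).symm).trans
    ((toTangent L i).quotKerEquivOfSurjective (toTangent_surjective L i))

end Tangent

end DGLA

theorem theorem2p19 {K : Type u} [Field K] [CharZero K] (L : DGLA.{u, v} K) :
    ∃ hF : IsDeformationFunctor L.Def,
      ∀ i : ℤ, ∃ e : L.H i ≃ₗ[K] hF.tangentSpace i,
        ∀ z : GradedSpace.cocycles L.gr L.d i,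
          ∃ m : (L.tensor (NilpDGA.line K (i - 1))).MC,
            m.1 = (z : L) ⊗ₜ[K] NilpDGA.Line.one K ∧
              e (Submodule.Quotient.mk z) = Quot.mk _ m :=
  -- The value on a class holds by definition, because the isomorphism is induced on the quotient by
  -- `z ↦ [z ⊗ 1]`.
  ⟨DGLA.isDeformationFunctor_def L, fun i => ⟨DGLA.tangentEquiv L i, fun z =>
    ⟨DGLA.lineMC L i z, rfl, rfl⟩⟩⟩
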